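/- Let $n\ge 2$ and identify $\mathbb{C}^n$ with $\mathbb{R}^{2n}$ by $(\xi_{11}+i\xi_{12},\dots,\xi_{n1}+i\xi_{n2})\mapsto(\xi_{11},\xi_{12},\dots,\xi_{n1},\xi_{n2})$. For $\xi\in S^{2n-1}$ let $H_\xi=\{z\in\mathbb{C}^n:\sum_{k=1}^n z_k\overline{\xi_k}=0\}$, regarded as a $(2n-2)$-dimensional subspace of $\mathbb{R}^{2n}$. A star body is a compact set $K\subset\mathbb{R}^{2n}$ with the origin in its interior such that every line through the origin crosses the boundary of $K$ in exactly two points different from the origin; its Minkowski functional is $\|x\|_K=\min\{a\ge 0: x\in aK\}$. $K$ is called continuous if $\|\cdot\|_K$ is continuous on $\mathbb{R}^{2n}$, and $R_\theta$-invariant if $\|\cdot\|_K$ is invariant under the simultaneous rotation of all pairs of coordinates $(\xi_{k1},\xi_{k2})$ by every angle $\theta\in[0,2\pi]$. The volume of a section with respect to the volume element of complex hyperbolic $(n-1)$-space in the ball model is $$\mathrm{HVol}_{2n-2}(K\cap H_\xi)=8^{n-1}\int_{K\cap H_\xi}\frac{dx}{(1-|x|^2)^{n}},$$ where $dx$ is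 the $(2n-2)$-dimensional Lebesgue measure on $H_\xi$. The Fourier transform of test functions is $\hat\varphi(y)=\int_{\mathbb{R}^{2n}}\varphi(x)e^{-i(x,y)}\,dx$, and that of a tempered distribution $f$ is given by $\langle\hat f,\varphi\rangle=\langle f,\hat\varphi\rangle$. Let $K$ be a continuous $R_\theta$-invariant star body in $\mathbb{R}^{2n}$ contained in the open unit ball. Then the function $$f(x)=|x|^{-2n+2}\int_0^{|x|/\|x\|_K}\frac{r^{2n-3}}{(1-r^2)^n}\,dr$$ defines by integration a tempered distribution on $\mathbb{R}^{2n}$, whose Fourier transform $\hat f$ is given by a function that is continuous on $\mathbb{R}^{2n}\setminus\{0\}$, and for every $\xi\in S^{2n-1}$ the volume $\mathrm{HVol}_{2n-2}(K\cap H_\xi)$ is finite and $$\mathrm{HVol}_{2n-2}(K\cap H_\xi)=\frac{8^{n-1}}{2\pi}\,\hat f(\xi).$$ -/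

import Mathlib

namespace ComplexHyperbolic

open MeasureTheory

noncomputable section

/-- The space `ℝ^{2n}` with its Euclidean structure; the coordinates `ξ_{k1}, ξ_{k2}` of a
vector `ξ` are `ξ (k, 0)` and `ξ (k, 1)`. -/
abbrev RSpace (n : ℕ) : Type := EuclideanSpace ℝ (Fin n × Fin 2)

/-- The `k`-th complex coordinate `ξ_{k1} + i ξ_{k2}` under the identification of `ℝ^{2n}`
with `ℂ^n`. -/
def cCoord {n : ℕ} (x : RSpace n) (k : Fin n) : ℂ := ⟨x (k, 0), x (k, 1)⟩

/-- The complex hyperplane `H_ξ = {z | ∑ k, z_k * conj ξ_k = 0}`, as a real subspace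
of `ℝ^{2n}`. -/
def complexHyperplane {n : ℕ} (ξ : RSpace n) : Submodule ℝ (RSpace n) where
  carrier := {x | ∑ k, cCoord x k * (starRingEnd ℂ) (cCoord ξ k) = 0}
  add_mem' := by
    intro x y hx hy
    have h : ∀ k, cCoord (x + y) k = cCoord x k + cCoord y k := fun k => by
      apply Complex.ext <;> simp [cCoord]
    change ∑ k, _ = _ at hx hy
    change ∑ k, _ = _
    simp only [h, add_mul, Finset.sum_add_distrib, hx, hy, add_zero]
  zero_mem' := by
    have h : ∀ k, cCoord (0 : RSpace n) k = 0 := fun k => by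
      apply Complex.ext <;> simp [cCoord]
    simp [h]
  smul_mem' := by
    intro c x hx
    have h : ∀ k, cCoord (c • x) k = (c : ℂ) * cCoord x k := fun k => by
      apply Complex.ext <;> simp [cCoord]
    change ∑ k, _ = _ at hx
    change ∑ k, _ = _
    simp only [h, mul_assoc, ← Finset.mul_sum, hx, mul_zero]

/-- The counterclockwise rotation by the angle `θ` applied to each pair of coordinates
`(ξ_{k1}, ξ_{k2})`. -/
def rotate {n : ℕ} (θ : ℝ) (x : RSpace n) : RSpace n :=
  WithLp.toLp 2 fun p : Fin n × Fin 2 =>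
    if p.2 = 0 then Real.cos θ * x (p.1, 0) - Real.sin θ * x (p.1, 1)
    else Real.sin θ * x (p.1, 0) + Real.cos θ * x (p.1, 1)

/-- A star body: a compact set with the origin in its interior such that every line through the
origin crosses the boundary in exactly two points different from the origin. -/
structure IsStarBody {E : Type*} [NormedAddCommGroup E] [NormedSpace ℝ E] (K : Set E) : Prop where
  isCompact : IsCompact K
  zero_mem_interior : (0 : E) ∈ interior K
  encard_line : ∀ x : E, x ≠ 0 →
    (((Submodule.span ℝ {x} : Submodule ℝ E) : Set E) ∩ (frontier K \ {0})).encard = 2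

/-- `R_θ`-invariance, in terms of the Minkowski functional `gauge K`. -/
def IsRotationInvariant {n : ℕ} (K : Set (RSpace n)) : Prop :=
  ∀ θ ∈ Set.Icc (0 : ℝ) (2 * Real.pi), ∀ x : RSpace n, gauge K x = gauge K (rotate θ x)

/-- The volume measure of complex hyperbolic `m`-space in the ball model, on the open unit ball of
a `2m`-dimensional Euclidean space `V`: it has the density `8 ^ m / (1 - r ^ 2) ^ (m + 1)` with
respect to Lebesgue measure `r ^ (2 m - 1) dr dσ`. -/
def hypMeasure (m : ℕ) (V : Type*) [NormedAddCommGroup V] [InnerProductSpace ℝ V]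
    [FiniteDimensional ℝ V] [MeasurableSpace V] [BorelSpace V] : Measure V :=
  (volume.restrict (Metric.ball (0 : V) 1)).withDensity
    fun x => ENNReal.ofReal (8 ^ m / (1 - ‖x‖ ^ 2) ^ (m + 1))

/-- The hyperbolic volume `HVol_{2n-2}(K ∩ H_ξ)` of a section by a complex hyperplane. -/
def hypSectionVolume {n : ℕ} (K : Set (RSpace n)) (ξ : RSpace n) : ENNReal :=
  hypMeasure (n - 1) (complexHyperplane ξ) {x | (x : RSpace n) ∈ K}

section Fourier

variable {E : Type*} [NormedAddCommGroup E] [InnerProductSpace ℝ E] [FiniteDimensional ℝ E]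
  [MeasurableSpace E] [BorelSpace E]

variable (E) in
/-- The Fourier transform `φ ↦ (y ↦ ∫ φ(x) exp(-i⟨x, y⟩) dx)` on Schwartz functions, obtained by
rescaling Mathlib's transform, whose kernel is `exp(-2πi⟨x, y⟩)`. -/
def schwartzFourier : SchwartzMap E ℂ →L[ℂ] SchwartzMap E ℂ :=
  (SchwartzMap.compCLMOfContinuousLinearEquiv ℂ
    (ContinuousLinearEquiv.smulLeft
      (Units.mk0 ((2 * Real.pi)⁻¹ : ℝ) (by positivity)) : E ≃L[ℝ] E)).comp
    (FourierTransform.fourierCLM ℂ (SchwartzMap E ℂ))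

theorem schwartzFourier_apply (φ : SchwartzMap E ℂ) (y : E) :
    schwartzFourier E φ y = ∫ x, Complex.exp (-((inner ℝ x y : ℝ) : ℂ) * Complex.I) * φ x := by
  have h : schwartzFourier E φ y =
      FourierTransform.fourier (φ : E → ℂ) ((2 * Real.pi)⁻¹ • y) := by
    rw [← SchwartzMap.fourier_coe]; rfl
  rw [h, Real.fourier_eq']
  refine integral_congr_ae (Filter.Eventually.of_forall fun x => ?_)
  have hpi : (Real.pi : ℂ) ≠ 0 := by exact_mod_cast Real.pi_ne_zero
  simp only [inner_smul_right, smul_eq_mul]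
  congr 2
  push_cast
  field_simp

/-- The Fourier transform of a tempered distribution, `⟨T^, φ⟩ = ⟨T, φ^⟩`. -/
def distFourier (T : TemperedDistribution E ℂ) : TemperedDistribution E ℂ :=
  PointwiseConvergenceCLM.precomp ℂ (schwartzFourier E) T

theorem distFourier_apply (T : TemperedDistribution E ℂ) (φ : SchwartzMap E ℂ) :
    distFourier T φ = T (schwartzFourier E φ) := rfl

/-- The tempered distribution `T` is given by integration against the function `f`. -/
def IsGivenBy (T : TemperedDistribution E ℂ) (f : E → ℝ) : Prop :=
  ∀ φ : SchwartzMap E ℂ,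
    Integrable (fun x => (f x : ℂ) * φ x) ∧ T φ = ∫ x, (f x : ℂ) * φ x

end Fourier

/-- The function `x ↦ |x|^{-2n+2} ∫_0^{|x| / ‖x‖_K} r^{2n-3} (1 - r^2)^{-n} dr`. -/
def sectionKernel {n : ℕ} (K : Set (RSpace n)) (x : RSpace n) : ℝ :=
  ‖x‖ ^ (-2 * (n : ℤ) + 2) *
    ∫ r in (0 : ℝ)..(‖x‖ / gauge K x), r ^ (2 * n - 3) / (1 - r ^ 2) ^ n

end

end ComplexHyperbolic

/-! The kernel `f` is homogeneous of degree `-(2n - 2)` and, `K` being `R_θ`-invariant, constant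
on the circles `{e^{iθ} x}`. Polar coordinates along the complex lines therefore turn `2π ⟨f, φ̂⟩`
into the pairing on the unit sphere of `f` with `x ↦ ∫_ℂ φ̂(z x) dz`, which by the Fourier slice
theorem is `(2π)² |x|⁻² ∫_{H_x} φ`. This operation on test functions is symmetric, as `φ ↦ φ̂` is,
so it can be moved onto `f`; hence `f̂(ξ)` is `2π` times the integral of `f` over the unit sphere
of `H_ξ`, and polar coordinates in `H_ξ` recognize this integral as the volume of `K ∩ H_ξ` with
density `(1 - |x|²)^{-n}`.

Integrals over spheres are replaced throughout by Lebesgue integrals against a fixed radial bump,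
normalized for the dilation invariant measure on the half-line, so that only Fubini's theorem and
changes of scale are needed.
-/

namespace ComplexHyperbolic

open MeasureTheory Filter Topology Set FourierTransform

noncomputable section

section Decay

variable {E F : Type*} [NormedAddCommGroup E]

theorem norm_schwartz_le_seminorm (𝕜 : Type*) [NormedField 𝕜] [NormedSpace ℝ E]
    [NormedAddCommGroup F] [NormedSpace ℝ F] [NormedSpace 𝕜 F] [SMulCommClass ℝ 𝕜 F]
    (φ : SchwartzMap E F) (N : ℕ) (x : E) :
    ‖φ x‖ ≤ 2 ^ N * (Finset.Iic (N, 0)).sup (schwartzSeminormFamily 𝕜 E F) φ *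
      ((1 + ‖x‖) ^ N)⁻¹ := by
  have h := SchwartzMap.one_add_le_sup_seminorm_apply (𝕜 := 𝕜) (m := (N, 0)) (le_refl N)
    (le_refl 0) φ x
  rw [norm_iteratedFDeriv_zero] at h
  rw [← div_eq_mul_inv, le_div_iff₀ (by positivity), mul_comm]
  exact h

theorem exists_norm_schwartz_le [NormedSpace ℝ E] [NormedAddCommGroup F] [NormedSpace ℝ F]
    (φ : SchwartzMap E F) (N : ℕ) : ∃ C, 0 ≤ C ∧ ∀ x, ‖φ x‖ ≤ C * ((1 + ‖x‖) ^ N)⁻¹ :=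
  ⟨_, by positivity, norm_schwartz_le_seminorm ℝ φ N⟩

variable [NormedSpace ℝ E] [FiniteDimensional ℝ E] [MeasurableSpace E] [BorelSpace E]
  {μ : Measure E} [μ.IsAddHaarMeasure]

theorem integrable_inv_one_add_norm_pow {N : ℕ} (hN : Module.finrank ℝ E < N) :
    Integrable (fun x : E => ((1 + ‖x‖) ^ N)⁻¹) μ := by
  have h := integrable_one_add_norm (E := E) (μ := μ) (r := N) (by exact_mod_cast hN)
  refine h.congr (Eventually.of_forall fun x => ?_)
  simp [Real.rpow_neg (by positivity : (0 : ℝ) ≤ 1 + ‖x‖)]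

theorem integrable_inv_norm_pow_mul {k : ℕ} (hk : k < Module.finrank ℝ E) :
    Integrable (fun x : E => (‖x‖ ^ k)⁻¹ * ((1 + ‖x‖) ^ (Module.finrank ℝ E + 1))⁻¹) μ := by
  have : Nontrivial E := Module.nontrivial_of_finrank_pos (R := ℝ) (by omega)
  set d := Module.finrank ℝ E with hd
  refine (integrable_fun_norm_addHaar μ
    (f := fun r => (r ^ k)⁻¹ * ((1 + r) ^ (d + 1))⁻¹)).2 ?_
  have hdom : IntegrableOn (fun r : ℝ => ((1 + ‖r‖) ^ 2)⁻¹) (Ioi 0) :=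
    (integrable_inv_one_add_norm_pow (E := ℝ) (by simp)).integrableOn
  refine Integrable.mono' hdom (by fun_prop) ?_
  refine (ae_restrict_iff' measurableSet_Ioi).2 (Eventually.of_forall fun r (hr : 0 < r) => ?_)
  rw [smul_eq_mul, Real.norm_of_nonneg (by positivity), Real.norm_of_nonneg hr.le, ← hd]
  have hexp : d - 1 = (d - 1 - k) + k := by omega
  rw [hexp, pow_add, mul_assoc, mul_inv_cancel_left₀ (by positivity), ← div_eq_mul_inv,
    div_le_iff₀ (by positivity), ← div_eq_inv_mul, le_div_iff₀ (by positivity)]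
  calc r ^ (d - 1 - k) * (1 + r) ^ 2 ≤ (1 + r) ^ (d - 1 - k) * (1 + r) ^ 2 := by
        gcongr; linarith
    _ = (1 + r) ^ (d - 1 - k + 2) := by rw [pow_add]
    _ ≤ (1 + r) ^ (d + 1) := pow_le_pow_right₀ (by linarith) (by omega)

theorem integrable_smul_schwartz {𝕜 : Type*} [NormedField 𝕜] [NormedAddCommGroup F]
    [NormedSpace ℝ F] [NormedSpace 𝕜 F] {k : ℕ} (hk : k < Module.finrank ℝ E) {f : E → 𝕜}
    (hf : AEStronglyMeasurable f μ) {C : ℝ} (hfC : ∀ x, ‖f x‖ ≤ C * (‖x‖ ^ k)⁻¹)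
    (φ : SchwartzMap E F) : Integrable (fun x => f x • φ x) μ := by
  obtain ⟨D, -, hφ⟩ := exists_norm_schwartz_le φ (Module.finrank ℝ E + 1)
  refine ((integrable_inv_norm_pow_mul hk).const_mul (C * D)).mono'
    (hf.smul φ.continuous.aestronglyMeasurable) (Eventually.of_forall fun x => ?_)
  rw [norm_smul]
  calc ‖f x‖ * ‖φ x‖ ≤ (C * (‖x‖ ^ k)⁻¹) * (D * ((1 + ‖x‖) ^ (Module.finrank ℝ E + 1))⁻¹) :=
        mul_le_mul (hfC x) (hφ x) (norm_nonneg _) ((norm_nonneg _).trans (hfC x))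
    _ = _ := by ring

theorem integrable_inv_norm_pow_smul_schwartz [NormedAddCommGroup F] [NormedSpace ℝ F] {k : ℕ}
    (hk : k < Module.finrank ℝ E) (φ : SchwartzMap E F) :
    Integrable (fun x => (‖x‖ ^ k)⁻¹ • φ x) μ :=
  integrable_smul_schwartz hk (f := fun x => (‖x‖ ^ k)⁻¹) (C := 1)
    (measurable_norm.pow_const k).inv.aestronglyMeasurable (by simp) φ

end Decay

section FourierSlice

variable {E F : Type*} [NormedAddCommGroup E] [InnerProductSpace ℝ E]

theorem norm_le_norm_add_orthogonal (K : Submodule ℝ E) (u : K) (y : Kᗮ) :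
    ‖(y : E)‖ ≤ ‖(u : E) + y‖ := by
  have h := norm_add_sq_eq_norm_sq_add_norm_sq_real (K.inner_right_of_mem_orthogonal u.2 y.2)
  nlinarith [norm_nonneg (y : E), norm_nonneg ((u : E) + y), mul_self_nonneg ‖(u : E)‖]

variable [FiniteDimensional ℝ E] [MeasurableSpace E] [BorelSpace E] [NormedAddCommGroup F]
  [NormedSpace ℂ F]

theorem measurePreserving_add_orthogonal (K : Submodule ℝ E) :
    MeasurePreserving (fun p : K × Kᗮ => (p.1 : E) + p.2) := by
  convert K.orthogonalDecomposition.symm.measurePreserving.comp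
    (WithLp.volume_preserving_symm_measurableEquiv_toLp_prod K Kᗮ).symm using 1
  funext p
  simp

theorem measurableEmbedding_add_orthogonal (K : Submodule ℝ E) :
    MeasurableEmbedding (fun p : K × Kᗮ => (p.1 : E) + p.2) := by
  convert (K.orthogonalDecomposition.symm.toHomeomorph.measurableEmbedding).comp
    (MeasurableEquiv.toLp 2 (K × Kᗮ)).measurableEmbedding using 1
  funext p
  simp

/-- The integrals of `f` over the translates of `Kᗮ`, as a function of the base point in `K`. -/
def fiberIntegral (K : Submodule ℝ E) (f : E → F) (u : K) : F := ∫ y : Kᗮ, f ((u : E) + y)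

theorem integrable_fiberIntegral (K : Submodule ℝ E) {f : E → F} (hf : Integrable f) :
    Integrable (fiberIntegral K f) :=
  (((measurePreserving_add_orthogonal K).integrable_comp_emb
    (measurableEmbedding_add_orthogonal K)).2 hf).integral_prod_left

theorem continuous_fiberIntegral (K : Submodule ℝ E) (φ : SchwartzMap E F) :
    Continuous (fiberIntegral K φ) := by
  obtain ⟨C, hC, hφ⟩ := exists_norm_schwartz_le φ (Module.finrank ℝ Kᗮ + 1)
  refine continuous_of_dominated
    (bound := fun y : Kᗮ => C * ((1 + ‖y‖) ^ (Module.finrank ℝ Kᗮ + 1))⁻¹)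
    (fun u => Continuous.aestronglyMeasurable (by fun_prop))
    (fun u => Eventually.of_forall fun y => (hφ _).trans ?_)
    ((integrable_inv_one_add_norm_pow (by simp)).const_mul C)
    (Eventually.of_forall fun y => by fun_prop)
  gcongr
  exact norm_le_norm_add_orthogonal K u y

theorem fourier_fiberIntegral (K : Submodule ℝ E) {f : E → F} (hf : Integrable f) (w : K) :
    𝓕 (fiberIntegral K f) w = 𝓕 f (w : E) := by
  have hmp := measurePreserving_add_orthogonal K
  have hemb := measurableEmbedding_add_orthogonal K
  have hint : Integrable (fun p : K × Kᗮ =>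
      Complex.exp (↑(-2 * Real.pi * inner ℝ ((p.1 : E) + p.2) (w : E)) * Complex.I) •
        f ((p.1 : E) + p.2)) := by
    refine ((hmp.integrable_comp_emb hemb).2 hf).bdd_smul 1
      (Continuous.aestronglyMeasurable (by fun_prop)) (Eventually.of_forall fun p => ?_)
    rw [Complex.norm_exp_ofReal_mul_I]
  rw [Real.fourier_eq', Real.fourier_eq', ← hmp.integral_comp hemb, Measure.volume_eq_prod,
    integral_prod _ hint]
  refine integral_congr_ae (Eventually.of_forall fun u => ?_)
  simp only [fiberIntegral, ← integral_smul]
  refine integral_congr_ae (Eventually.of_forall fun y => ?_)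
  simp [inner_add_left, K.inner_left_of_mem_orthogonal w.2 y.2]

theorem integrable_schwartz_subspace (K : Submodule ℝ E) (φ : SchwartzMap E F) :
    Integrable (fun w : K => φ w) := by
  obtain ⟨C, -, hφ⟩ := exists_norm_schwartz_le φ (Module.finrank ℝ K + 1)
  exact ((integrable_inv_one_add_norm_pow (by simp)).const_mul C).mono'
    (Continuous.aestronglyMeasurable (by fun_prop)) (Eventually.of_forall fun w => hφ w)

theorem integral_fourier_subspace [CompleteSpace F] (K : Submodule ℝ E) (φ : SchwartzMap E F) :
    ∫ w : K, 𝓕 φ (w : E) = ∫ y : Kᗮ, φ y := by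
  have hfourier : 𝓕 (fiberIntegral K φ) = fun w : K => 𝓕 φ (w : E) := funext fun w => by
    rw [fourier_fiberIntegral K φ.integrable, SchwartzMap.fourier_coe]
  have inversion := congrFun ((continuous_fiberIntegral K φ).fourierInv_fourier_eq
    (integrable_fiberIntegral K φ.integrable)
    (hfourier ▸ integrable_schwartz_subspace K (𝓕 φ))) 0
  simpa [Real.fourierInv_eq', hfourier, fiberIntegral] using inversion

end FourierSlice

section Homogeneous

variable {𝕜 E F : Type*} [NormedField 𝕜] [NormedAddCommGroup E] [NormedSpace 𝕜 E]
  [NormedAddCommGroup F] [NormedSpace ℝ F]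

variable (𝕜) in
/-- Absolute homogeneity of degree `-k`; for `k ≠ 0` it forces the value `0` at the origin. -/
def IsNegHomogeneous (k : ℕ) (f : E → F) : Prop :=
  ∀ ⦃c : 𝕜⦄, c ≠ 0 → ∀ x, f (c • x) = (‖c‖ ^ k)⁻¹ • f x

namespace IsNegHomogeneous

variable {k : ℕ} {f : E → F}

theorem restrictScalars [NormedAlgebra ℝ 𝕜] [NormedSpace ℝ E] [IsScalarTower ℝ 𝕜 E]
    (hf : IsNegHomogeneous 𝕜 k f) : IsNegHomogeneous ℝ k f := fun c hc x => by
  rw [← algebraMap_smul 𝕜 c x, hf (by simpa using hc), norm_algebraMap']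

variable [NormedSpace ℝ E]

theorem map_zero (hf : IsNegHomogeneous ℝ k f) (hk : k ≠ 0) : f 0 = 0 := by
  have h := hf two_ne_zero 0
  rw [smul_zero, Real.norm_two, eq_inv_smul_iff₀ (by positivity)] at h
  have hsub : ((2 : ℝ) ^ k - 1) • f 0 = 0 := by rw [sub_smul, one_smul, h, sub_self]
  exact (smul_eq_zero.1 hsub).resolve_left (sub_ne_zero.2 (one_lt_pow₀ one_lt_two hk).ne')

theorem eq_inv_norm_pow_smul (hf : IsNegHomogeneous ℝ k f) {x : E} (hx : x ≠ 0) :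
    f x = (‖x‖ ^ k)⁻¹ • f (‖x‖⁻¹ • x) := by
  conv_lhs => rw [← smul_inv_smul₀ (norm_ne_zero_iff.2 hx) x]
  rw [hf (norm_ne_zero_iff.2 hx), norm_norm]

theorem exists_norm_le [FiniteDimensional ℝ E] (hf : IsNegHomogeneous ℝ k f) (hk : k ≠ 0)
    (hcont : ContinuousOn f {0}ᶜ) : ∃ C, ∀ x, ‖f x‖ ≤ C * (‖x‖ ^ k)⁻¹ := by
  obtain ⟨C, hC⟩ := (isCompact_sphere (0 : E) 1).exists_bound_of_continuousOn
    (hcont.mono fun x hx => Metric.ne_of_mem_sphere hx one_ne_zero)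
  refine ⟨C, fun x => ?_⟩
  rcases eq_or_ne x 0 with rfl | hx
  · simp [hf.map_zero hk, hk]
  rw [hf.eq_inv_norm_pow_smul hx, norm_smul, Real.norm_of_nonneg (by positivity), mul_comm]
  gcongr
  exact hC _ (by simp [norm_smul, hx])

end IsNegHomogeneous

end Homogeneous

section ComplexStructure

variable {E : Type*} [NormedAddCommGroup E] [InnerProductSpace ℝ E] [NormedSpace ℂ E]

theorem inner_complex_smul_smul (z : ℂ) (x y : E) :
    inner ℝ (z • x) (z • y) = ‖z‖ ^ 2 * inner ℝ x y := by
  simp only [real_inner_eq_norm_add_mul_self_sub_norm_mul_self_sub_norm_mul_self_div_two,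
    ← smul_add, norm_smul]
  ring

variable [IsScalarTower ℝ ℂ E]

theorem inner_complex_smul_left (z : ℂ) (x y : E) :
    inner ℝ (z • x) y = inner ℝ x ((starRingEnd ℂ) z • y) := by
  rcases eq_or_ne z 0 with rfl | hz
  · simp
  have hconj : (starRingEnd ℂ) z • y = ‖z‖ ^ 2 • z⁻¹ • y := by
    rw [← smul_assoc, Complex.inv_def, Complex.normSq_eq_norm_sq, Complex.real_smul, mul_left_comm,
      ← Complex.ofReal_mul, mul_inv_cancel₀ (by simp [hz]), Complex.ofReal_one, mul_one]
  rw [hconj, inner_smul_right, ← inner_complex_smul_smul, smul_inv_smul₀ hz]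

/-- The complex hyperplane orthogonal to `x`, as a real subspace. -/
def complexOrthogonal (x : E) : Submodule ℝ E :=
  (Submodule.restrictScalars ℝ (Submodule.span ℂ {x}))ᗮ

theorem mem_complexOrthogonal {x y : E} :
    y ∈ complexOrthogonal x ↔ ∀ z : ℂ, inner ℝ (z • x) y = 0 := by
  simp [complexOrthogonal, Submodule.mem_orthogonal, Submodule.mem_span_singleton]

theorem complexOrthogonal_smul {r : ℝ} (hr : r ≠ 0) (x : E) :
    complexOrthogonal (r • x) = complexOrthogonal x := by
  have h : Submodule.span ℂ {r • x} = Submodule.span ℂ {x} := by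
    rw [← algebraMap_smul ℂ r x]
    exact Submodule.span_singleton_smul_eq (by simpa using hr) x
  rw [complexOrthogonal, complexOrthogonal, h]

theorem finrank_complexOrthogonal [FiniteDimensional ℝ E] {x : E} (hx : x ≠ 0) :
    Module.finrank ℝ (complexOrthogonal x) = Module.finrank ℝ E - 2 := by
  have h := (Submodule.restrictScalars ℝ (Submodule.span ℂ {x})).finrank_add_finrank_orthogonal
  have hline : Module.finrank ℝ (Submodule.restrictScalars ℝ (Submodule.span ℂ {x})) = 2 := by
    rw [← mul_one 2, ← finrank_span_singleton (K := ℂ) hx, ← Complex.finrank_real_complex]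
    exact (Module.finrank_mul_finrank ℝ ℂ (Submodule.span ℂ {x})).symm
  rw [complexOrthogonal]
  omega

/-- Multiplication by a complex number of modulus one, as an isometry. -/
def unitSMul (u : Circle) : E ≃ₗᵢ[ℝ] E where
  toFun x := (u : ℂ) • x
  map_add' := smul_add (u : ℂ)
  map_smul' r x := smul_comm (u : ℂ) r x
  invFun x := (u : ℂ)⁻¹ • x
  left_inv := inv_smul_smul₀ u.coe_ne_zero
  right_inv := smul_inv_smul₀ u.coe_ne_zero
  norm_map' x := (norm_smul (u : ℂ) x).trans (by rw [u.norm_coe, one_mul])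

end ComplexStructure

section ComplexLineIntegral

variable {E F : Type*} [NormedAddCommGroup E] [NormedSpace ℂ E] [NormedAddCommGroup F]

theorem integrable_inv_one_add_norm_mul_pow {r : ℝ} (hr : 0 < r) :
    Integrable fun z : ℂ => ((1 + ‖z‖ * r) ^ 3)⁻¹ := by
  simpa only [norm_smul, Real.norm_of_nonneg hr.le, mul_comm r] using
    (integrable_inv_one_add_norm_pow (E := ℂ) (μ := volume) (N := 3) (by simp)).comp_smul hr.ne'

theorem integrable_comp_complex_smul {G : E → F} (hG : Continuous G) {D : ℝ}
    (hD : ∀ x, ‖G x‖ ≤ D * ((1 + ‖x‖) ^ 3)⁻¹) {x : E} (hx : x ≠ 0) :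
    Integrable fun z : ℂ => G (z • x) := by
  refine ((integrable_inv_one_add_norm_mul_pow (norm_pos_iff.2 hx)).const_mul D).mono'
    (Continuous.aestronglyMeasurable (by fun_prop)) (Eventually.of_forall fun z => ?_)
  rw [← norm_smul]
  exact hD _

variable [NormedSpace ℝ F]

/-- The integral of `G` over the complex line through `x`, parametrized by `z ↦ z • x`. -/
def complexLineIntegral (G : E → F) (x : E) : F := ∫ z : ℂ, G (z • x)

theorem continuousOn_complexLineIntegral {G : E → F} (hG : Continuous G) {D : ℝ}
    (hD : ∀ x, ‖G x‖ ≤ D * ((1 + ‖x‖) ^ 3)⁻¹) : ContinuousOn (complexLineIntegral G) {0}ᶜ := by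
  intro x₀ hx₀
  have hpos : 0 < ‖x₀‖ := norm_pos_iff.2 hx₀
  have hD₀ : 0 ≤ D := by simpa using (norm_nonneg _).trans (hD 0)
  have hnear : ∀ᶠ x in 𝓝 x₀, ‖x₀‖ / 2 < ‖x‖ :=
    continuous_norm.continuousAt.eventually (lt_mem_nhds (half_lt_self hpos))
  refine ContinuousAt.continuousWithinAt (continuousAt_of_dominated
    (Eventually.of_forall fun x => Continuous.aestronglyMeasurable (by fun_prop)) ?_
    ((integrable_inv_one_add_norm_mul_pow (half_pos hpos)).const_mul D)
    (Eventually.of_forall fun z => Continuous.continuousAt (by fun_prop)))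
  filter_upwards [hnear] with x hx
  refine Eventually.of_forall fun z => (hD _).trans ?_
  rw [norm_smul]
  gcongr

variable [InnerProductSpace ℝ E] [IsScalarTower ℝ ℂ E]

theorem isNegHomogeneous_complexLineIntegral (G : E → F) :
    IsNegHomogeneous ℝ 2 (complexLineIntegral G) := fun r _ x => by
  have h := Measure.integral_comp_smul volume (fun z : ℂ => G (z • x)) r
  rw [Complex.finrank_real_complex, abs_inv, abs_pow, ← Real.norm_eq_abs] at h
  simp only [complexLineIntegral, ← h, smul_assoc, smul_comm r]

variable [FiniteDimensional ℝ E]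

theorem exists_norm_complexLineIntegral_le {G : E → F} (hG : Continuous G) {D : ℝ}
    (hD : ∀ x, ‖G x‖ ≤ D * ((1 + ‖x‖) ^ 3)⁻¹) :
    ∃ C, ∀ x, ‖complexLineIntegral G x‖ ≤ C * (‖x‖ ^ 2)⁻¹ :=
  (isNegHomogeneous_complexLineIntegral G).exists_norm_le two_ne_zero
    (continuousOn_complexLineIntegral hG hD)

variable [MeasurableSpace E] [BorelSpace E]

/-- The integral of `h` over the complex hyperplane orthogonal to `x`. -/
def hyperplaneIntegral (h : E → F) (x : E) : F := ∫ y : complexOrthogonal x, h y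

theorem integral_comp_smul_unit (G : E → F) {x : E} (hx : ‖x‖ = 1) :
    ∫ w : Submodule.restrictScalars ℝ (Submodule.span ℂ {x}), G w =
      complexLineIntegral G x := by
  let e : ℂ ≃ₗᵢ[ℝ] Submodule.restrictScalars ℝ (Submodule.span ℂ {x}) :=
    { (LinearIsometryEquiv.toSpanUnitSingleton (𝕜 := ℂ) x hx).toLinearEquiv.restrictScalars ℝ with
      norm_map' := (LinearIsometryEquiv.toSpanUnitSingleton (𝕜 := ℂ) x hx).norm_map }
  exact (e.measurePreserving.integral_comp e.toHomeomorph.measurableEmbedding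
    fun w => G (w : E)).symm

theorem complexLineIntegral_fourier {H : Type*} [NormedAddCommGroup H] [NormedSpace ℂ H]
    [CompleteSpace H] (φ : SchwartzMap E H) {x : E} (hx : x ≠ 0) :
    complexLineIntegral (𝓕 φ : SchwartzMap E H) x = (‖x‖ ^ 2)⁻¹ • hyperplaneIntegral φ x := by
  rw [(isNegHomogeneous_complexLineIntegral _).eq_inv_norm_pow_smul hx,
    ← integral_comp_smul_unit _ (by simp [norm_smul, hx]), integral_fourier_subspace,
    ← complexOrthogonal, complexOrthogonal_smul (by simpa using hx), hyperplaneIntegral]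

theorem complexLineIntegral_schwartzFourier (φ : SchwartzMap E ℂ) {x : E} (hx : x ≠ 0) :
    complexLineIntegral (schwartzFourier E φ) x =
      ((2 * Real.pi) ^ 2 * (‖x‖ ^ 2)⁻¹) • hyperplaneIntegral φ x := by
  have hscale : complexLineIntegral (schwartzFourier E φ) x =
      complexLineIntegral (𝓕 φ : SchwartzMap E ℂ) ((2 * Real.pi)⁻¹ • x) :=
    integral_congr_ae (Eventually.of_forall fun z =>
      congrArg (𝓕 φ : SchwartzMap E ℂ) (smul_comm (2 * Real.pi)⁻¹ z x))
  rw [hscale, isNegHomogeneous_complexLineIntegral _ (by positivity),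
    complexLineIntegral_fourier φ hx, smul_smul, Real.norm_of_nonneg (by positivity), inv_pow,
    inv_inv]

theorem integral_mul_schwartzFourier_smul (φ ψ : SchwartzMap E ℂ) (z : ℂ) :
    ∫ x, φ x * schwartzFourier E ψ (z • x) =
      ∫ y, ψ y * schwartzFourier E φ ((starRingEnd ℂ) z • y) := by
  have hint : Integrable (fun p : E × E => φ p.1 *
      (Complex.exp (-((inner ℝ p.2 (z • p.1) : ℝ) : ℂ) * Complex.I) * ψ p.2))
      (volume.prod volume) := by
    refine (φ.integrable.mul_prod ψ.integrable).mono
      (Continuous.aestronglyMeasurable (by fun_prop)) (Eventually.of_forall fun p => ?_)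
    rw [norm_mul, norm_mul, norm_mul, ← Complex.ofReal_neg, Complex.norm_exp_ofReal_mul_I, one_mul]
  simp_rw [schwartzFourier_apply, ← integral_const_mul]
  rw [integral_integral_swap hint]
  refine integral_congr_ae (Eventually.of_forall fun y =>
    integral_congr_ae (Eventually.of_forall fun x => ?_))
  have hadj : inner ℝ y (z • x) = inner ℝ x ((starRingEnd ℂ) z • y) := by
    rw [real_inner_comm, inner_complex_smul_left]
  simp only [hadj]
  ring

theorem integrable_mul_comp_smul [Nontrivial E] {h : E → ℂ}
    (hint : Integrable fun x => (‖x‖ ^ 2)⁻¹ • h x) (hh : AEStronglyMeasurable h)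
    (G : SchwartzMap E ℂ) :
    Integrable (fun p : E × ℂ => h p.1 * G (p.2 • p.1)) (volume.prod volume) := by
  obtain ⟨D, -, hG⟩ := exists_norm_schwartz_le G 3
  have hmeas : AEStronglyMeasurable (fun p : E × ℂ => h p.1 * G (p.2 • p.1))
      (volume.prod volume) := hh.comp_fst.mul (Continuous.aestronglyMeasurable (by fun_prop))
  refine (integrable_prod_iff hmeas).2 ⟨?_, ?_⟩
  · filter_upwards [Measure.ae_ne volume (0 : E)] with x hx
    exact (integrable_comp_complex_smul G.continuous hG hx).const_mul _
  · have hG' : ∀ x, ‖‖G x‖‖ ≤ D * ((1 + ‖x‖) ^ 3)⁻¹ := by simpa only [norm_norm] using hG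
    obtain ⟨C, hC⟩ := exists_norm_complexLineIntegral_le G.continuous.norm hG'
    refine (hint.norm.const_mul C).mono' hmeas.norm.integral_prod_right'
      (Eventually.of_forall fun x => ?_)
    simp only [norm_mul, integral_const_mul, norm_smul, norm_norm, norm_inv, norm_pow]
    calc ‖h x‖ * ‖∫ z : ℂ, ‖G (z • x)‖‖ ≤ ‖h x‖ * (C * (‖x‖ ^ 2)⁻¹) := by gcongr; exact hC x
      _ = C * ((‖x‖ ^ 2)⁻¹ * ‖h x‖) := by ring

theorem integral_mul_complexLineIntegral_comm (hE : 2 < Module.finrank ℝ E)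
    (φ ψ : SchwartzMap E ℂ) :
    ∫ x, φ x * complexLineIntegral (schwartzFourier E ψ) x =
      ∫ y, ψ y * complexLineIntegral (schwartzFourier E φ) y := by
  have : Nontrivial E := Module.nontrivial_of_finrank_pos (R := ℝ) (by omega)
  have hint := fun φ ψ : SchwartzMap E ℂ => integrable_mul_comp_smul
    (integrable_inv_norm_pow_smul_schwartz hE φ) φ.continuous.aestronglyMeasurable ψ
  simp_rw [complexLineIntegral, ← integral_const_mul]
  calc ∫ x, ∫ z : ℂ, φ x * schwartzFourier E ψ (z • x)
      = ∫ z : ℂ, ∫ x, φ x * schwartzFourier E ψ (z • x) :=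
        integral_integral_swap (hint φ _)
    _ = ∫ z : ℂ, ∫ y, ψ y * schwartzFourier E φ ((starRingEnd ℂ) z • y) := by
        simp_rw [integral_mul_schwartzFourier_smul φ ψ]
    _ = ∫ z : ℂ, ∫ y, ψ y * schwartzFourier E φ (z • y) :=
        Complex.conjLIE.measurePreserving.integral_comp
          Complex.conjLIE.toHomeomorph.measurableEmbedding
          fun z => ∫ y, ψ y * schwartzFourier E φ (z • y)
    _ = ∫ y, ∫ z : ℂ, ψ y * schwartzFourier E φ (z • y) :=
        (integral_integral_swap (hint ψ _)).symm

end ComplexLineIntegral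

section UniformApproximation

theorem exists_seq_schwartz_tendstoUniformly {E F : Type*} [NormedAddCommGroup E]
    [NormedSpace ℝ E] [FiniteDimensional ℝ E] [NormedAddCommGroup F] [NormedSpace ℝ F]
    {h : E → F} (hh : Continuous h) (hsupp : HasCompactSupport h) :
    ∃ ψ : ℕ → SchwartzMap E F, TendstoUniformly (fun j => ⇑(ψ j)) h atTop ∧
      ∀ j, Function.support (ψ j) ⊆ Function.support h := by
  choose g hg hdist hsub using fun j : ℕ => hh.exists_contDiff_approx
    (ε := fun _ => 1 / ((j : ℝ) + 1)) ⊤ continuous_const fun _ => Nat.one_div_pos_of_nat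
  refine ⟨fun j => (hsupp.mono (hsub j)).toSchwartzMap (hg j), ?_, hsub⟩
  refine Metric.tendstoUniformly_iff.2 fun ε hε => ?_
  filter_upwards [tendsto_one_div_add_atTop_nhds_zero_nat.eventually (gt_mem_nhds hε)] with j hj x
  rw [dist_comm]
  exact (hdist j x).trans hj

theorem tendsto_integral_mul_of_tendstoUniformlyOn {α ι 𝕜 : Type*} [MeasurableSpace α]
    [RCLike 𝕜] {μ : Measure α} {l : Filter ι} [l.IsCountablyGenerated] {s : Set α}
    (hs : ∀ᵐ x ∂μ, x ∈ s) {u J : α → 𝕜} (hu : Integrable u μ) {I : ι → α → 𝕜}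
    (hI : ∀ i, AEStronglyMeasurable (I i) μ) {M : ℝ} (hJ : ∀ x ∈ s, ‖J x‖ ≤ M)
    (hIJ : TendstoUniformlyOn I J l s) :
    Tendsto (fun i => ∫ x, u x * I i x ∂μ) l (𝓝 (∫ x, u x * J x ∂μ)) := by
  refine tendsto_integral_filter_of_dominated_convergence (fun x => ‖u x‖ * (1 + M))
    (Eventually.of_forall fun i => hu.aestronglyMeasurable.mul (hI i)) ?_ (hu.norm.mul_const _) ?_
  · filter_upwards [Metric.tendstoUniformlyOn_iff.1 hIJ 1 one_pos] with i hi
    filter_upwards [hs] with x hx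
    have hclose : ‖I i x - J x‖ ≤ 1 := by
      rw [← dist_eq_norm, dist_comm]
      exact (hi x hx).le
    rw [norm_mul]
    gcongr
    linarith [norm_le_norm_add_norm_sub' (I i x) (J x), hJ x hx]
  · filter_upwards [hs] with x hx
    exact (hIJ.tendsto_at hx).const_mul _

theorem tendsto_integral_mul_of_locallyIntegrable {E 𝕜 : Type*} [TopologicalSpace E]
    [MeasurableSpace E] [OpensMeasurableSpace E] [RCLike 𝕜] {μ : Measure E} {u h : E → 𝕜}
    (hu : LocallyIntegrable u μ) (hh : Continuous h) (hsupp : HasCompactSupport h) {ψ : ℕ → E → 𝕜}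
    (hψ : ∀ j, Continuous (ψ j)) (hψh : TendstoUniformly ψ h atTop)
    (hsub : ∀ j, Function.support (ψ j) ⊆ Function.support h) :
    Tendsto (fun j => ∫ x, u x * ψ j x ∂μ) atTop (𝓝 (∫ x, u x * h x ∂μ)) := by
  have hset : ∀ g : E → 𝕜, Function.support g ⊆ Function.support h →
      ∫ x in tsupport h, u x * g x ∂μ = ∫ x, u x * g x ∂μ := fun g hg =>
    setIntegral_eq_integral_of_forall_compl_eq_zero fun x hx => by
      rw [Function.notMem_support.1 fun hgx => hx (subset_tsupport h (hg hgx)), mul_zero]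
  obtain ⟨M, hM⟩ := hh.bounded_above_of_compact_support hsupp
  simp only [← hset h le_rfl, ← hset (ψ _) (hsub _)]
  exact tendsto_integral_mul_of_tendstoUniformlyOn (Eventually.of_forall mem_univ)
    (hu.integrableOn_isCompact hsupp.isCompact) (fun j => (hψ j).aestronglyMeasurable)
    (fun x _ => hM x) (tendstoUniformlyOn_univ.2 hψh)

end UniformApproximation

section HyperplaneIntegral

theorem volume_closedBall_eq_of_finrank_eq {V W : Type*} [NormedAddCommGroup V]
    [InnerProductSpace ℝ V] [FiniteDimensional ℝ V] [MeasurableSpace V] [BorelSpace V]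
    [NormedAddCommGroup W] [InnerProductSpace ℝ W] [FiniteDimensional ℝ W] [MeasurableSpace W]
    [BorelSpace W] (h : Module.finrank ℝ V = Module.finrank ℝ W) (R : ℝ) :
    volume (Metric.closedBall (0 : V) R) = volume (Metric.closedBall (0 : W) R) := by
  have e := (stdOrthonormalBasis ℝ V).equiv (stdOrthonormalBasis ℝ W) (finCongr h)
  rw [← e.measurePreserving.measure_preimage measurableSet_closedBall.nullMeasurableSet,
    e.preimage_closedBall, map_zero]

variable {E F : Type*} [NormedAddCommGroup E] [InnerProductSpace ℝ E] [NormedSpace ℂ E]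
  [IsScalarTower ℝ ℂ E] [FiniteDimensional ℝ E] [MeasurableSpace E] [BorelSpace E]
  [NormedAddCommGroup F]

theorem integrable_comp_complexOrthogonal {h : E → F} (hh : Continuous h)
    (hsupp : HasCompactSupport h) (x : E) : Integrable fun y : complexOrthogonal x => h y :=
  have hclosed := (complexOrthogonal x).closed_of_finiteDimensional
  (hh.comp continuous_subtype_val).integrable_of_hasCompactSupport
    (hsupp.comp_isClosedEmbedding hclosed.isClosedEmbedding_subtypeVal)

variable [NormedSpace ℝ F]

theorem exists_norm_hyperplaneIntegral_le (R : ℝ) :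
    ∃ V, 0 ≤ V ∧ ∀ (h : E → F) (ε : ℝ), Function.support h ⊆ Metric.closedBall 0 R →
      (∀ y, ‖h y‖ ≤ ε) → ∀ x ≠ 0, ‖hyperplaneIntegral h x‖ ≤ ε * V := by
  let ball : Set (EuclideanSpace ℝ (Fin (Module.finrank ℝ E - 2))) := Metric.closedBall 0 R
  refine ⟨volume.real ball, measureReal_nonneg, fun h ε hsupp hε x hx => ?_⟩
  have hball : volume (Metric.closedBall (0 : complexOrthogonal x) R) = volume ball :=
    volume_closedBall_eq_of_finrank_eq (by simp [finrank_complexOrthogonal hx]) R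
  rw [hyperplaneIntegral, ← setIntegral_eq_integral_of_forall_compl_eq_zero
    (s := Metric.closedBall (0 : complexOrthogonal x) R), measureReal_def, ← hball]
  · exact norm_setIntegral_le_of_norm_le_const measure_closedBall_lt_top fun y _ => hε y
  · intro y hy
    by_contra hne
    exact hy (by simpa using hsupp hne)

theorem tendstoUniformlyOn_hyperplaneIntegral {ι : Type*} {l : Filter ι} {ψ : ι → E → F}
    {h : E → F} (hψ : ∀ i, Continuous (ψ i)) (hh : Continuous h) (hsupp : HasCompactSupport h)
    (hsub : ∀ i, Function.support (ψ i) ⊆ Function.support h) (hψh : TendstoUniformly ψ h l) :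
    TendstoUniformlyOn (fun i => hyperplaneIntegral (ψ i)) (hyperplaneIntegral h) l {0}ᶜ := by
  obtain ⟨R, hR⟩ := hsupp.isCompact.isBounded.subset_closedBall 0
  obtain ⟨V, hV, hbound⟩ := exists_norm_hyperplaneIntegral_le (E := E) (F := F) R
  refine Metric.tendstoUniformlyOn_iff.2 fun ε hε => ?_
  filter_upwards [Metric.tendstoUniformly_iff.1 hψh (ε / (V + 1)) (by positivity)] with i hi x hx
  have hsub_integral : hyperplaneIntegral h x - hyperplaneIntegral (ψ i) x =
      hyperplaneIntegral (h - ψ i) x :=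
    (integral_sub (integrable_comp_complexOrthogonal hh hsupp x)
      (integrable_comp_complexOrthogonal (hψ i) (hsupp.mono (hsub i)) x)).symm
  rw [dist_eq_norm, hsub_integral]
  calc ‖hyperplaneIntegral (h - ψ i) x‖ ≤ ε / (V + 1) * V := by
        refine hbound _ _ (((Function.support_sub _ _).trans
          (union_subset le_rfl (hsub i))).trans ((subset_tsupport h).trans hR)) (fun y => ?_) x hx
        simpa only [Pi.sub_apply, ← dist_eq_norm] using (hi y).le
    _ < ε := by
        rw [div_mul_eq_mul_div, div_lt_iff₀ (by positivity)]
        nlinarith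

section Schwartz

variable {H : Type*} [NormedAddCommGroup H] [NormedSpace ℂ H] [CompleteSpace H]

theorem continuousOn_hyperplaneIntegral_schwartz (φ : SchwartzMap E H) :
    ContinuousOn (hyperplaneIntegral φ) {0}ᶜ := by
  obtain ⟨D, -, hD⟩ := exists_norm_schwartz_le (𝓕 φ : SchwartzMap E H) 3
  have hcont : ContinuousOn
      (fun x => (‖x‖ ^ 2 : ℝ) • complexLineIntegral (𝓕 φ : SchwartzMap E H) x) {0}ᶜ :=
    (continuous_norm.pow 2).continuousOn.smul
      (continuousOn_complexLineIntegral (𝓕 φ : SchwartzMap E H).continuous hD)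
  refine hcont.congr fun x (hx : x ≠ 0) => ?_
  simp only [complexLineIntegral_fourier φ hx]
  rw [smul_inv_smul₀ (by simpa using hx)]

theorem continuousOn_hyperplaneIntegral {h : E → H} (hh : Continuous h)
    (hsupp : HasCompactSupport h) : ContinuousOn (hyperplaneIntegral h) {0}ᶜ := by
  obtain ⟨ψ, hψh, hsub⟩ := exists_seq_schwartz_tendstoUniformly hh hsupp
  exact (tendstoUniformlyOn_hyperplaneIntegral (fun j => (ψ j).continuous) hh hsupp hsub
    hψh).continuousOn (Frequently.of_forall fun j => continuousOn_hyperplaneIntegral_schwartz (ψ j))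

end Schwartz

theorem locallyIntegrable_complexLineIntegral_schwartz (hE : 2 < Module.finrank ℝ E)
    (φ : SchwartzMap E ℂ) : LocallyIntegrable (complexLineIntegral φ) := by
  obtain ⟨D, -, hD⟩ := exists_norm_schwartz_le φ 3
  obtain ⟨C, hC⟩ := exists_norm_complexLineIntegral_le φ.continuous hD
  exact locallyIntegrable_of_norm_le_rpow (α := 2) (by omega) (by exact_mod_cast hE)
    (Eventually.of_forall fun x => by simpa [Real.rpow_neg] using hC x)
    (measurable_of_continuousOn_compl_singleton 0
      (continuousOn_complexLineIntegral φ.continuous hD)).aestronglyMeasurable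

theorem tendsto_integral_schwartz_mul_hyperplaneIntegral (hE : 2 < Module.finrank ℝ E)
    (φ : SchwartzMap E ℂ) {h : E → ℂ} (hh : Continuous h) (hsupp : HasCompactSupport h)
    {ψ : ℕ → SchwartzMap E ℂ} (hψh : TendstoUniformly (fun j => ⇑(ψ j)) h atTop)
    (hsub : ∀ j, Function.support (ψ j) ⊆ Function.support h) :
    Tendsto (fun j => ∫ x, (‖x‖ ^ 2)⁻¹ • φ x * hyperplaneIntegral (ψ j) x) atTop
      (𝓝 (∫ x, (‖x‖ ^ 2)⁻¹ • φ x * hyperplaneIntegral h x)) := by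
  have : Nontrivial E := Module.nontrivial_of_finrank_pos (R := ℝ) (by omega)
  obtain ⟨R, hR⟩ := hsupp.isCompact.isBounded.subset_closedBall 0
  obtain ⟨M, hM⟩ := hh.bounded_above_of_compact_support hsupp
  obtain ⟨V, -, hV⟩ := exists_norm_hyperplaneIntegral_le (E := E) (F := ℂ) R
  exact tendsto_integral_mul_of_tendstoUniformlyOn (Measure.ae_ne volume 0)
    (integrable_inv_norm_pow_smul_schwartz hE φ)
    (fun j => (measurable_of_continuousOn_compl_singleton 0
      (continuousOn_hyperplaneIntegral_schwartz (ψ j))).aestronglyMeasurable)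
    (hV h M ((subset_tsupport h).trans hR) hM)
    (tendstoUniformlyOn_hyperplaneIntegral (fun j => (ψ j).continuous) hh hsupp hsub hψh)

theorem integral_inv_norm_sq_smul_mul_hyperplaneIntegral (hE : 2 < Module.finrank ℝ E)
    (φ : SchwartzMap E ℂ) {h : E → ℂ} (hh : Continuous h) (hsupp : HasCompactSupport h) :
    (2 * Real.pi : ℂ) ^ 2 * ∫ x, (‖x‖ ^ 2)⁻¹ • φ x * hyperplaneIntegral h x =
      ∫ x, complexLineIntegral (schwartzFourier E φ) x * h x := by
  have : Nontrivial E := Module.nontrivial_of_finrank_pos (R := ℝ) (by omega)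
  obtain ⟨ψ, hψh, hsub⟩ := exists_seq_schwartz_tendstoUniformly hh hsupp
  refine tendsto_nhds_unique
    ((tendsto_integral_schwartz_mul_hyperplaneIntegral hE φ hh hsupp hψh hsub).const_mul _)
    ((tendsto_integral_mul_of_locallyIntegrable
      (locallyIntegrable_complexLineIntegral_schwartz hE _) hh hsupp
      (fun j => (ψ j).continuous) hψh hsub).congr fun j => ?_)
  calc ∫ x, complexLineIntegral (schwartzFourier E φ) x * ψ j x
      = ∫ x, φ x * complexLineIntegral (schwartzFourier E (ψ j)) x := by
        rw [integral_mul_complexLineIntegral_comm hE]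
        simp only [mul_comm]
    _ = _ := by
        rw [← integral_const_mul]
        refine integral_congr_ae ((Measure.ae_ne volume 0).mono fun x hx => ?_)
        simp only [complexLineIntegral_schwartzFourier (ψ j) hx, Complex.real_smul]
        push_cast
        ring

end HyperplaneIntegral

section RadialBump

/-- A nonnegative continuous function supported in `(1, 3)` and normalized for the dilation
invariant measure `t⁻¹ dt` on the half-line. -/
def radialBump (t : ℝ) : ℝ :=
  t * (⟨1 / 2, 1, by norm_num, by norm_num⟩ : ContDiffBump (2 : ℝ)).normed volume t

theorem continuous_radialBump : Continuous radialBump :=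
  continuous_id.mul (ContDiffBump.continuous_normed _)

theorem support_radialBump_subset : Function.support radialBump ⊆ Ioo 1 3 := fun t ht => by
  have h : t ∈ Metric.ball (2 : ℝ) 1 := by
    rw [← ContDiffBump.support_normed_eq ⟨1 / 2, 1, by norm_num, by norm_num⟩ (μ := volume)]
    exact right_ne_zero_of_mul ht
  rw [Real.ball_eq_Ioo] at h
  norm_num at h ⊢
  exact h

theorem radialBump_nonneg (t : ℝ) : 0 ≤ radialBump t := by
  by_contra! h
  exact h.not_ge (mul_nonneg (zero_le_one.trans (support_radialBump_subset h.ne).1.le)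
    (ContDiffBump.nonneg_normed _ t))

theorem integral_inv_mul_radialBump : ∫ t in Ioi (0 : ℝ), t⁻¹ * radialBump t = 1 := by
  let b : ContDiffBump (2 : ℝ) := ⟨1 / 2, 1, by norm_num, by norm_num⟩
  have hcancel : EqOn (fun t => t⁻¹ * radialBump t) (b.normed volume) (Ioi 0) :=
    fun t (ht : 0 < t) => inv_mul_cancel_left₀ ht.ne' _
  rw [setIntegral_congr_fun measurableSet_Ioi hcancel,
    setIntegral_eq_integral_of_forall_compl_eq_zero, b.integral_normed]
  intro t (ht : ¬ 0 < t)
  rw [← Function.notMem_support, b.support_normed_eq, Real.ball_eq_Ioo]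
  exact fun h => ht (by linarith [h.1])

theorem integral_inv_mul_radialBump_div {t : ℝ} (ht : 0 < t) :
    ∫ s in Ioi (0 : ℝ), s⁻¹ * radialBump (t / s) = 1 := by
  have hinv := integral_comp_rpow_Ioi (fun s => s⁻¹ * radialBump (t * s))
    (neg_ne_zero.2 one_ne_zero : (-1 : ℝ) ≠ 0)
  have hmul := integral_comp_mul_left_Ioi (fun s => s⁻¹ * radialBump s) 0 ht
  calc ∫ s in Ioi (0 : ℝ), s⁻¹ * radialBump (t / s)
      = ∫ s in Ioi (0 : ℝ), s⁻¹ * radialBump (t * s) := by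
        rw [← hinv]
        refine setIntegral_congr_fun measurableSet_Ioi fun s (hs : 0 < s) => ?_
        have hpow : s ^ (-1 - 1 : ℝ) = s⁻¹ * s⁻¹ := by
          rw [sub_eq_add_neg, Real.rpow_add hs, Real.rpow_neg_one]
        simp only [hpow, Real.rpow_neg_one, abs_neg, abs_one, smul_eq_mul, div_eq_mul_inv]
        field_simp
    _ = t * ∫ s in Ioi (0 : ℝ), (t * s)⁻¹ * radialBump (t * s) := by
        rw [← integral_const_mul]
        refine setIntegral_congr_fun measurableSet_Ioi fun s _ => ?_
        field_simp
    _ = 1 := by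
        rw [hmul, mul_zero, integral_inv_mul_radialBump, smul_eq_mul, mul_one,
          mul_inv_cancel₀ ht.ne']

theorem lintegral_inv_mul_radialBump_div {t : ℝ} (ht : 0 < t) :
    ∫⁻ s in Ioi (0 : ℝ), ENNReal.ofReal (s⁻¹ * radialBump (t / s)) = 1 := by
  have h := integral_inv_mul_radialBump_div ht
  rw [← ofReal_integral_eq_lintegral_ofReal (.of_integral_ne_zero (h ▸ one_ne_zero)), h,
    ENNReal.ofReal_one]
  exact (ae_restrict_iff' measurableSet_Ioi).2 (Eventually.of_forall fun s (hs : 0 < s) =>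
    mul_nonneg (inv_nonneg.2 hs.le) (radialBump_nonneg _))

theorem integral_complex_inv_mul_radialBump_div {t : ℝ} (ht : 0 < t) :
    ∫ z : ℂ, (‖z‖ ^ 2)⁻¹ * radialBump (t / ‖z‖) = 2 * Real.pi := by
  rw [integral_fun_norm_addHaar (volume : Measure ℂ)
    (fun r => (r ^ 2)⁻¹ * radialBump (t / r)), setIntegral_congr_fun measurableSet_Ioi
    (g := fun r => r⁻¹ * radialBump (t / r)), integral_inv_mul_radialBump_div ht]
  · simp [measureReal_def]
  · intro r (hr : 0 < r)
    simp only [Complex.finrank_real_complex, smul_eq_mul, Nat.add_one_sub_one, pow_one]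
    field_simp

end RadialBump

section RadialCutoff

variable {E F : Type*} [NormedAddCommGroup E] [NormedAddCommGroup F] [NormedSpace ℝ F]

/-- Cutting `f` off to a spherical shell. For `f` of degree `-d` in dimension `d`, the integral
of the cutoff stands for the integral of `f` over the unit sphere. -/
def radialCutoff (f : E → F) (x : E) : F := radialBump ‖x‖ • f x

theorem radialCutoff_ofReal (f : E → ℝ) :
    radialCutoff (fun y => (f y : ℂ)) = fun y => ((radialCutoff f y : ℝ) : ℂ) := funext fun y => by
  simp only [radialCutoff, Complex.real_smul, smul_eq_mul, Complex.ofReal_mul]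

theorem radialCutoff_inv_smul {𝕜 : Type*} [NormedField 𝕜] [NormedSpace 𝕜 E] {k : ℕ} {f : E → F}
    (hf : IsNegHomogeneous 𝕜 k f) {z : 𝕜} (hz : z ≠ 0) (x : E) :
    radialCutoff f (z⁻¹ • x) = (‖z‖ ^ k * radialBump (‖x‖ / ‖z‖)) • f x := by
  rw [radialCutoff, hf (inv_ne_zero hz), smul_smul, norm_smul, norm_inv, inv_pow, inv_inv,
    mul_comm, inv_mul_eq_div]

theorem one_lt_norm_of_radialCutoff_ne_zero {f : E → F} {x : E} (hx : radialCutoff f x ≠ 0) :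
    1 < ‖x‖ :=
  (support_radialBump_subset (smul_ne_zero_iff.1 hx).1).1

theorem continuous_radialCutoff {f : E → F} (hf : ContinuousOn f {0}ᶜ) :
    Continuous (radialCutoff f) := by
  refine continuous_iff_continuousAt.2 fun x => ?_
  rcases lt_or_ge ‖x‖ 1 with hx | hx
  · refine continuousAt_const.congr (f := fun _ => (0 : F)) ?_
    filter_upwards [continuous_norm.continuousAt.eventually (gt_mem_nhds hx)] with y hy
    by_contra hne
    exact hy.not_gt (one_lt_norm_of_radialCutoff_ne_zero fun h => hne h.symm)
  · have hx₀ : x ≠ 0 := norm_pos_iff.1 (zero_lt_one.trans_le hx)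
    exact (continuous_radialBump.comp continuous_norm).continuousAt.smul
      (hf.continuousAt (isOpen_compl_singleton.mem_nhds hx₀))

theorem hasCompactSupport_radialCutoff [ProperSpace E] (f : E → F) :
    HasCompactSupport (radialCutoff f) :=
  .of_support_subset_isCompact (isCompact_closedBall 0 3) fun x hx => by
    simpa using (support_radialBump_subset (smul_ne_zero_iff.1 hx).1).2.le

theorem integrable_inv_norm_sq_smul_radialCutoff [ProperSpace E] [MeasurableSpace E]
    [BorelSpace E] {μ : Measure E} [IsFiniteMeasureOnCompacts μ] {f : E → F}
    (hcont : ContinuousOn f {0}ᶜ) : Integrable (fun x => (‖x‖ ^ 2)⁻¹ • radialCutoff f x) μ := by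
  have hint := (continuous_radialCutoff hcont).integrable_of_hasCompactSupport (μ := μ)
    (hasCompactSupport_radialCutoff f)
  refine hint.mono (AEStronglyMeasurable.smul (by fun_prop) hint.aestronglyMeasurable)
    (Eventually.of_forall fun x => ?_)
  rcases eq_or_ne (radialCutoff f x) 0 with hx | hx
  · simp [hx]
  · rw [norm_smul, norm_inv, norm_pow, norm_norm]
    exact mul_le_of_le_one_left (norm_nonneg _)
      (inv_le_one_of_one_le₀ (one_le_pow₀ (one_lt_norm_of_radialCutoff_ne_zero hx).le))

end RadialCutoff

section RadialAveraging

section Real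

variable {V : Type*} [NormedAddCommGroup V] [NormedSpace ℝ V] [FiniteDimensional ℝ V]
  [MeasurableSpace V] [BorelSpace V] {μ : Measure V} [μ.IsAddHaarMeasure]

theorem lintegral_eq_mul_lintegral_comp_smul {r : ℝ} (hr : 0 < r) (f : V → ENNReal) :
    ∫⁻ x, f x ∂μ = ENNReal.ofReal (r ^ Module.finrank ℝ V) * ∫⁻ x, f (r • x) ∂μ := by
  have hmap : ∫⁻ x, f (r • x) ∂μ = ∫⁻ x, f x ∂μ.map (r • ·) :=
    (lintegral_map_equiv f (Homeomorph.smulOfNeZero r hr.ne' : V ≃ₜ V).toMeasurableEquiv).symm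
  rw [hmap, Measure.map_addHaar_smul μ hr.ne', lintegral_smul_measure, smul_eq_mul, ← mul_assoc,
    ← ENNReal.ofReal_mul (by positivity), abs_of_nonneg (by positivity),
    mul_inv_cancel₀ (by positivity), ENNReal.ofReal_one, one_mul]

theorem lintegral_eq_lintegral_radialBump_mul [Nontrivial V] {W : V → ENNReal}
    (hW : Measurable W) :
    ∫⁻ x, W x ∂μ = ∫⁻ x, (ENNReal.ofReal (radialBump ‖x‖) *
      ∫⁻ s in Ioi (0 : ℝ), ENNReal.ofReal (s ^ (Module.finrank ℝ V - 1)) * W (s • x)) ∂μ := by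
  have hρ := continuous_radialBump.measurable
  have hd : 0 < Module.finrank ℝ V := Module.finrank_pos
  calc ∫⁻ x, W x ∂μ
      = ∫⁻ x, (∫⁻ s in Ioi (0 : ℝ), ENNReal.ofReal (s⁻¹ * radialBump (‖x‖ / s)) * W x) ∂μ := by
        refine lintegral_congr_ae ((Measure.ae_ne μ 0).mono fun x hx => ?_)
        simp only
        rw [lintegral_mul_const _ (by fun_prop),
          lintegral_inv_mul_radialBump_div (norm_pos_iff.2 hx), one_mul]
    _ = ∫⁻ s in Ioi (0 : ℝ), ∫⁻ x, ENNReal.ofReal (s⁻¹ * radialBump (‖x‖ / s)) * W x ∂μ :=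
        lintegral_lintegral_swap (Measurable.aemeasurable (by fun_prop))
    _ = ∫⁻ s in Ioi (0 : ℝ), ∫⁻ x, ENNReal.ofReal (radialBump ‖x‖) *
          (ENNReal.ofReal (s ^ (Module.finrank ℝ V - 1)) * W (s • x)) ∂μ := by
        refine setLIntegral_congr_fun measurableSet_Ioi fun s (hs : 0 < s) => ?_
        rw [lintegral_eq_mul_lintegral_comp_smul hs, ← lintegral_const_mul _ (by fun_prop)]
        refine lintegral_congr fun x => ?_
        rw [norm_smul, Real.norm_of_nonneg hs.le, mul_div_cancel_left₀ _ hs.ne', ← mul_assoc,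
          ← mul_assoc, ← ENNReal.ofReal_mul (by positivity), ← ENNReal.ofReal_mul
          (radialBump_nonneg _), ← mul_assoc, ← div_eq_mul_inv, ← pow_sub_one_mul hd.ne',
          mul_div_cancel_right₀ _ hs.ne', mul_comm (radialBump _)]
    _ = _ := by
        rw [lintegral_lintegral_swap (Measurable.aemeasurable (by fun_prop))]
        exact lintegral_congr fun x => lintegral_const_mul _ (by fun_prop)

theorem integrable_radialBump_div_smul [Nontrivial V] {F : Type*} [NormedAddCommGroup F]
    [NormedSpace ℝ F] {G : V → F} (hG : Integrable G μ) :
    Integrable (fun p : V × ℂ => ((‖p.2‖ ^ 2)⁻¹ * radialBump (‖p.1‖ / ‖p.2‖)) • G p.1)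
      (μ.prod volume) := by
  have hρ := continuous_radialBump.measurable
  have hmeas : AEStronglyMeasurable
      (fun p : V × ℂ => ((‖p.2‖ ^ 2)⁻¹ * radialBump (‖p.1‖ / ‖p.2‖)) • G p.1)
      (μ.prod volume) :=
    (Measurable.aestronglyMeasurable (by fun_prop)).smul hG.aestronglyMeasurable.comp_fst
  refine (integrable_prod_iff hmeas).2 ⟨?_, (hG.norm.const_mul (2 * Real.pi)).congr ?_⟩
  · filter_upwards [Measure.ae_ne μ 0] with x hx
    refine Integrable.smul_const (.of_integral_ne_zero ?_) _
    rw [integral_complex_inv_mul_radialBump_div (norm_pos_iff.2 hx)]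
    positivity
  · filter_upwards [Measure.ae_ne μ 0] with x hx
    rw [← integral_complex_inv_mul_radialBump_div (norm_pos_iff.2 hx), ← integral_mul_const]
    refine integral_congr_ae (Eventually.of_forall fun z => ?_)
    simp only
    rw [norm_smul, Real.norm_of_nonneg (mul_nonneg (by positivity) (radialBump_nonneg _))]

end Real

section Complex

variable {E F : Type*} [NormedAddCommGroup E] [InnerProductSpace ℝ E] [NormedSpace ℂ E]
  [IsScalarTower ℝ ℂ E] [FiniteDimensional ℝ E] [MeasurableSpace E] [BorelSpace E]
  [NormedAddCommGroup F] [NormedSpace ℝ F]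

theorem integral_comp_complex_smul (G : E → F) (z : ℂ) :
    ∫ x, G (z • x) = (‖z‖ ^ Module.finrank ℝ E)⁻¹ • ∫ x, G x := by
  let u := unitSMul (E := E) (Circle.exp z.arg)
  have hz : ∀ x : E, z • x = ‖z‖ • u x := fun x => by
    conv_lhs => rw [← z.norm_mul_exp_arg_mul_I, mul_smul, ← Circle.coe_exp]
    exact algebraMap_smul ℂ ‖z‖ (u x)
  simp only [hz]
  rw [u.measurePreserving.integral_comp u.toHomeomorph.measurableEmbedding
    (fun x => G (‖z‖ • x)), Measure.integral_comp_smul_of_nonneg _ _ _ (hR := norm_nonneg z)]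

theorem integral_comp_smul_mul_radialCutoff {f : E → ℂ} (hE : 2 ≤ Module.finrank ℝ E)
    (hf : IsNegHomogeneous ℂ (Module.finrank ℝ E - 2) f) (G : E → ℂ) {z : ℂ} (hz : z ≠ 0) :
    ∫ x, radialCutoff f x * G (z • x) =
      ∫ x, ((‖z‖ ^ 2)⁻¹ * radialBump (‖x‖ / ‖z‖)) • (f x * G x) := by
  have h := integral_comp_complex_smul (fun x => radialCutoff f (z⁻¹ • x) * G x) z
  simp only [inv_smul_smul₀ hz] at h
  rw [h, ← integral_smul]
  refine integral_congr_ae (Eventually.of_forall fun x => ?_)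
  simp only
  rw [radialCutoff_inv_smul hf hz, smul_mul_assoc, smul_smul, ← mul_assoc]
  congr 2
  rw [inv_mul_eq_iff_eq_mul₀ (by positivity), ← Nat.sub_add_cancel hE, pow_add,
    mul_inv_cancel_right₀ (by positivity), Nat.add_sub_cancel]

theorem integral_radialCutoff_mul_complexLineIntegral (hE : 2 ≤ Module.finrank ℝ E) {f : E → ℂ}
    (hf : IsNegHomogeneous ℂ (Module.finrank ℝ E - 2) f) (hcont : ContinuousOn f {0}ᶜ)
    (G : SchwartzMap E ℂ) (hint : Integrable fun x => f x * G x) :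
    ∫ x, radialCutoff f x * complexLineIntegral G x = 2 * Real.pi * ∫ x, f x * G x := by
  have : Nontrivial E := Module.nontrivial_of_finrank_pos (R := ℝ) (by omega)
  simp_rw [complexLineIntegral, ← integral_const_mul]
  calc ∫ x, ∫ z : ℂ, radialCutoff f x * G (z • x)
      = ∫ z : ℂ, ∫ x, radialCutoff f x * G (z • x) :=
        integral_integral_swap (integrable_mul_comp_smul
          (integrable_inv_norm_sq_smul_radialCutoff hcont)
          (continuous_radialCutoff hcont).aestronglyMeasurable G)
    _ = ∫ z : ℂ, ∫ x, ((‖z‖ ^ 2)⁻¹ * radialBump (‖x‖ / ‖z‖)) • (f x * G x) :=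
        integral_congr_ae ((Measure.ae_ne volume 0).mono fun z hz =>
          integral_comp_smul_mul_radialCutoff hE hf G hz)
    _ = ∫ x, ∫ z : ℂ, ((‖z‖ ^ 2)⁻¹ * radialBump (‖x‖ / ‖z‖)) • (f x * G x) :=
        (integral_integral_swap (integrable_radialBump_div_smul hint)).symm
    _ = ∫ x, 2 * Real.pi * (f x * G x) := by
        refine integral_congr_ae ((Measure.ae_ne volume 0).mono fun x hx => ?_)
        simp only
        rw [integral_smul_const, integral_complex_inv_mul_radialBump_div (norm_pos_iff.2 hx),
          Complex.real_smul, Complex.ofReal_mul, Complex.ofReal_ofNat]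

end Complex

end RadialAveraging

section TemperedDistribution

variable {E F : Type*} [NormedAddCommGroup E] [InnerProductSpace ℝ E] [FiniteDimensional ℝ E]
  [MeasurableSpace E] [BorelSpace E]

theorem exists_norm_integral_smul_schwartz_le [NormedAddCommGroup F] [NormedSpace ℂ F] {k : ℕ}
    (hk : k < Module.finrank ℝ E) {f : E → ℝ} {C : ℝ} (hfC : ∀ x, ‖f x‖ ≤ C * (‖x‖ ^ k)⁻¹) :
    ∃ (s : Finset (ℕ × ℕ)) (D : ℝ), 0 ≤ D ∧ ∀ φ : SchwartzMap E F,
      ‖∫ x, f x • φ x‖ ≤ D * s.sup (schwartzSeminormFamily ℂ E F) φ := by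
  let N := Module.finrank ℝ E + 1
  let bound : E → ℝ := fun x => C * (‖x‖ ^ k)⁻¹ * ((1 + ‖x‖) ^ N)⁻¹
  have hbound : Integrable bound := by
    simpa only [bound, mul_assoc] using (integrable_inv_norm_pow_mul hk).const_mul C
  have hbound_nonneg : 0 ≤ ∫ x, bound x := integral_nonneg fun x =>
    mul_nonneg ((norm_nonneg _).trans (hfC x)) (by positivity)
  refine ⟨Finset.Iic (N, 0), 2 ^ N * ∫ x, bound x, by positivity, fun φ => ?_⟩
  rw [mul_right_comm, ← integral_const_mul]
  refine norm_integral_le_of_norm_le (hbound.const_mul _) (Eventually.of_forall fun x => ?_)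
  rw [norm_smul]
  calc ‖f x‖ * ‖φ x‖ ≤ C * (‖x‖ ^ k)⁻¹ *
        (2 ^ N * (Finset.Iic (N, 0)).sup (schwartzSeminormFamily ℂ E F) φ *
          ((1 + ‖x‖) ^ N)⁻¹) :=
        mul_le_mul (hfC x) (norm_schwartz_le_seminorm ℂ φ N x) (norm_nonneg _)
          ((norm_nonneg _).trans (hfC x))
    _ = _ := by ring

theorem exists_isGivenBy {k : ℕ} (hk : k < Module.finrank ℝ E) {f : E → ℝ}
    (hf : AEStronglyMeasurable f) {C : ℝ} (hfC : ∀ x, ‖f x‖ ≤ C * (‖x‖ ^ k)⁻¹) :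
    ∃ T : TemperedDistribution E ℂ, IsGivenBy T f := by
  have hint : ∀ φ : SchwartzMap E ℂ, Integrable fun x => f x • φ x :=
    integrable_smul_schwartz hk hf hfC
  let T : SchwartzMap E ℂ →L[ℂ] ℂ := SchwartzMap.mkCLMtoNormedSpace
    (fun φ => ∫ x, f x • φ x)
    (fun φ ψ => by simp only [add_apply, smul_add, integral_add (hint φ) (hint ψ)])
    (fun c φ => by simp only [smul_apply, smul_comm _ c, integral_smul, RingHom.id_apply])
    (exists_norm_integral_smul_schwartz_le hk hfC)
  exact ⟨ContinuousLinearMap.toPointwiseConvergenceCLM _ _ _ _ T, fun φ =>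
    ⟨by simpa only [Complex.real_smul] using hint φ, rfl⟩⟩

end TemperedDistribution

section FourierDensity

variable {E : Type*} [NormedAddCommGroup E] [InnerProductSpace ℝ E] [NormedSpace ℂ E]
  [IsScalarTower ℝ ℂ E] [FiniteDimensional ℝ E] [MeasurableSpace E] [BorelSpace E] {f : E → ℝ}

/-- The density of the Fourier transform of a function `f` on a complex vector space of real
dimension `d` that is absolutely homogeneous over `ℂ` of degree `-(d - 2)`: up to a homogeneous
factor, the integral of `f` over the unit sphere of the complex hyperplane orthogonal to `x`. -/
def fourierDensity (f : E → ℝ) (x : E) : ℝ :=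
  2 * Real.pi * (‖x‖ ^ 2)⁻¹ * hyperplaneIntegral (radialCutoff f) x

theorem hyperplaneIntegral_ofReal (h : E → ℝ) (x : E) :
    hyperplaneIntegral (fun y => (h y : ℂ)) x = ((hyperplaneIntegral h x : ℝ) : ℂ) :=
  integral_ofReal

theorem continuousOn_fourierDensity (hcont : ContinuousOn f {0}ᶜ) :
    ContinuousOn (fourierDensity f) {0}ᶜ := by
  have hI : ContinuousOn (hyperplaneIntegral (radialCutoff f)) {0}ᶜ := by
    have h := continuousOn_hyperplaneIntegral (h := fun y => ((radialCutoff f y : ℝ) : ℂ))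
      (Complex.continuous_ofReal.comp (continuous_radialCutoff hcont))
      ((hasCompactSupport_radialCutoff f).comp_left Complex.ofReal_zero)
    simpa only [hyperplaneIntegral_ofReal, Function.comp_def, Complex.ofReal_re] using
      Complex.continuous_re.comp_continuousOn h
  refine ContinuousOn.mul (ContinuousOn.mul (by fun_prop) (ContinuousOn.inv₀ (by fun_prop) ?_)) hI
  exact fun x hx => pow_ne_zero 2 (norm_ne_zero_iff.2 hx)

theorem exists_norm_fourierDensity_le (hcont : ContinuousOn f {0}ᶜ) :
    ∃ C, ∀ x, ‖fourierDensity f x‖ ≤ C * (‖x‖ ^ 2)⁻¹ := by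
  have hsupp := hasCompactSupport_radialCutoff f
  obtain ⟨R, hR⟩ := hsupp.isCompact.isBounded.subset_closedBall 0
  obtain ⟨M, hM⟩ := (continuous_radialCutoff hcont).bounded_above_of_compact_support hsupp
  obtain ⟨V, -, hV⟩ := exists_norm_hyperplaneIntegral_le (E := E) (F := ℝ) R
  refine ⟨2 * Real.pi * (M * V), fun x => ?_⟩
  rcases eq_or_ne x 0 with rfl | hx
  · simp [fourierDensity]
  rw [fourierDensity, norm_mul, Real.norm_of_nonneg (by positivity), mul_right_comm]
  gcongr
  exact hV _ _ ((subset_tsupport _).trans hR) hM x hx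

theorem integral_fourierDensity_mul (hE : 2 < Module.finrank ℝ E)
    (hf : IsNegHomogeneous ℂ (Module.finrank ℝ E - 2) f) (hcont : ContinuousOn f {0}ᶜ)
    (φ : SchwartzMap E ℂ) (hint : Integrable fun x => (f x : ℂ) * schwartzFourier E φ x) :
    ∫ x, (fourierDensity f x : ℂ) * φ x = ∫ x, (f x : ℂ) * schwartzFourier E φ x := by
  let F : E → ℂ := fun x => f x
  let I : ℂ := ∫ x, (‖x‖ ^ 2)⁻¹ • φ x * hyperplaneIntegral (radialCutoff F) x
  have hFhom : IsNegHomogeneous ℂ (Module.finrank ℝ E - 2) F := fun z hz x => by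
    simp only [F, hf hz, Complex.real_smul, smul_eq_mul, Complex.ofReal_mul]
  have hFcont : ContinuousOn F {0}ᶜ := Complex.continuous_ofReal.comp_continuousOn hcont
  have hdensity : ∫ x, (fourierDensity f x : ℂ) * φ x = 2 * Real.pi * I := by
    rw [← integral_const_mul]
    refine integral_congr_ae (Eventually.of_forall fun x => ?_)
    simp only [F, radialCutoff_ofReal, hyperplaneIntegral_ofReal, fourierDensity, Complex.real_smul]
    push_cast
    ring
  have hslice : (2 * Real.pi) ^ 2 * I = 2 * Real.pi * ∫ x, F x * schwartzFourier E φ x := by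
    rw [← integral_radialCutoff_mul_complexLineIntegral hE.le hFhom hFcont _ hint,
      integral_inv_norm_sq_smul_mul_hyperplaneIntegral hE φ (continuous_radialCutoff hFcont)
        (hasCompactSupport_radialCutoff F)]
    simp only [mul_comm]
  have hpi : (2 * Real.pi : ℂ) ≠ 0 := by exact_mod_cast Real.two_pi_pos.ne'
  rw [hdensity]
  exact mul_left_cancel₀ hpi (by rw [← hslice, ← mul_assoc, ← pow_two])

theorem isGivenBy_distFourier (hE : 2 < Module.finrank ℝ E)
    (hf : IsNegHomogeneous ℂ (Module.finrank ℝ E - 2) f) (hcont : ContinuousOn f {0}ᶜ)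
    {T : TemperedDistribution E ℂ} (hT : IsGivenBy T f) :
    IsGivenBy (distFourier T) (fourierDensity f) := fun φ => by
  have : Nontrivial E := Module.nontrivial_of_finrank_pos (R := ℝ) (by omega)
  obtain ⟨C, hC⟩ := exists_norm_fourierDensity_le hcont
  have hmeas := measurable_of_continuousOn_compl_singleton 0 (continuousOn_fourierDensity hcont)
  obtain ⟨hint, hTφ⟩ := hT (schwartzFourier E φ)
  refine ⟨?_, ?_⟩
  · simpa only [Complex.real_smul] using
      integrable_smul_schwartz hE hmeas.aestronglyMeasurable hC φ
  · rw [distFourier_apply, hTφ, integral_fourierDensity_mul hE hf hcont φ hint]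

theorem exists_isGivenBy_of_isNegHomogeneous (hE : 2 < Module.finrank ℝ E)
    (hf : IsNegHomogeneous ℂ (Module.finrank ℝ E - 2) f) (hcont : ContinuousOn f {0}ᶜ) :
    ∃ T : TemperedDistribution E ℂ, IsGivenBy T f := by
  have : Nontrivial E := Module.nontrivial_of_finrank_pos (R := ℝ) (by omega)
  obtain ⟨C, hC⟩ := hf.restrictScalars.exists_norm_le (by omega) hcont
  exact exists_isGivenBy (by omega)
    (measurable_of_continuousOn_compl_singleton 0 hcont).aestronglyMeasurable hC

end FourierDensity

section StarBody

theorem inter_frontier_nonempty_of_isPreconnected {X : Type*} [TopologicalSpace X] {s t : Set X}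
    (hs : IsPreconnected s) (ht : (s ∩ t).Nonempty) (htc : (s \ t).Nonempty) :
    (s ∩ frontier t).Nonempty := by
  have := Subtype.preconnectedSpace hs
  obtain ⟨x, hxs, hxt⟩ := ht
  obtain ⟨y, hys, hyt⟩ := htc
  obtain ⟨z, hz⟩ : (frontier (Subtype.val ⁻¹' t : Set s)).Nonempty :=
    nonempty_frontier_iff.2 ⟨⟨⟨x, hxs⟩, hxt⟩, fun h => hyt (h.ge (mem_univ (⟨y, hys⟩ : s)))⟩
  exact ⟨z, z.2, continuous_subtype_val.frontier_preimage_subset t hz⟩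

theorem mem_frontier_of_isGreatest {S : Set ℝ} {u : ℝ} (hu : IsGreatest S u) : u ∈ frontier S :=
  ⟨subset_closure hu.1, fun h => by simpa using interior_mono (t := Iic u) hu.2 h⟩

theorem mem_frontier_of_isLeast {S : Set ℝ} {l : ℝ} (hl : IsLeast S l) : l ∈ frontier S :=
  ⟨subset_closure hl.1, fun h => by simpa using interior_mono (t := Ici l) hl.2 h⟩

theorem convex_of_encard_frontier_le_two {S : Set ℝ} (hS : IsCompact S)
    (hint : (interior S).Nonempty) (hfr : (frontier S).encard ≤ 2) : Convex ℝ S := by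
  have hne : S.Nonempty := hint.mono interior_subset
  obtain ⟨l, hl⟩ := hS.exists_isLeast hne
  obtain ⟨u, hu⟩ := hS.exists_isGreatest hne
  suffices Icc l u ⊆ S from
    this.antisymm (fun x hx => ⟨hl.2 hx, hu.2 hx⟩) ▸ convex_Icc l u
  refine fun b hb => not_not.1 fun hbS => ?_
  obtain ⟨a, ha⟩ := hint
  have haS := interior_subset ha
  obtain ⟨w, hw, hwf⟩ := inter_frontier_nonempty_of_isPreconnected isPreconnected_uIcc
    ⟨a, left_mem_uIcc, haS⟩ ⟨b, right_mem_uIcc, hbS⟩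
  have hwa : w ≠ a := fun h => hwf.2 (h ▸ ha)
  have hwb : w ≠ b := fun h => hbS (h ▸ hS.isClosed.frontier_subset hwf)
  have hlw : l < w := (le_min (hl.2 haS) hb.1).trans_lt
    (hw.1.lt_of_ne' (by rcases min_choice a b with h | h <;> rwa [h]))
  have hwu : w < u := (hw.2.lt_of_ne (by rcases max_choice a b with h | h <;> rwa [h])).trans_le
    (max_le (hu.2 haS) hb.2)
  have hcard : ({l, w, u} : Set ℝ).encard ≤ 2 := (encard_le_encard (by
    rintro x (rfl | rfl | rfl)
    exacts [mem_frontier_of_isLeast hl, hwf, mem_frontier_of_isGreatest hu])).trans hfr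
  rw [encard_eq_three.2 ⟨l, w, u, hlw.ne, (hlw.trans hwu).ne, hwu.ne, rfl⟩] at hcard
  exact absurd hcard (by decide)

variable {E : Type*} [NormedAddCommGroup E] [NormedSpace ℝ E] {K : Set E}

namespace IsStarBody

theorem zero_mem (hK : IsStarBody K) : (0 : E) ∈ K :=
  interior_subset hK.zero_mem_interior

theorem absorbent (hK : IsStarBody K) : Absorbent ℝ K :=
  absorbent_nhds_zero (mem_interior_iff_mem_nhds.1 hK.zero_mem_interior)

theorem isVonNBounded (hK : IsStarBody K) : Bornology.IsVonNBounded ℝ K :=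
  hK.isCompact.isVonNBounded ℝ

theorem encard_frontier_preimage_smul_le_two (hK : IsStarBody K) {x : E} (hx : x ≠ 0) :
    (frontier ((fun t : ℝ => t • x) ⁻¹' K)).encard ≤ 2 := by
  have hmaps : MapsTo (fun t : ℝ => t • x) (frontier ((fun t : ℝ => t • x) ⁻¹' K))
      ((Submodule.span ℝ {x} : Submodule ℝ E) ∩ (frontier K \ {0})) := fun t ht => by
    have htf : t • x ∈ frontier K :=
      Continuous.frontier_preimage_subset (f := fun t : ℝ => t • x) (by fun_prop) K ht
    have h0 : t • x ≠ 0 := fun h => htf.2 (by rw [h]; exact hK.zero_mem_interior)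
    exact ⟨Submodule.smul_mem _ _ (Submodule.mem_span_singleton_self x), htf, h0⟩
  rw [← hK.encard_line x hx]
  exact encard_le_encard_of_injOn hmaps (smul_left_injective ℝ hx).injOn

theorem starConvex (hK : IsStarBody K) : StarConvex ℝ 0 K := by
  refine starConvex_zero_iff.2 fun x hxK s hs0 hs1 => ?_
  rcases eq_or_ne x 0 with rfl | hx
  · rwa [smul_zero]
  have hline : Topology.IsClosedEmbedding fun t : ℝ => t • x := isClosedEmbedding_smul_left hx
  have hconv := convex_of_encard_frontier_le_two (hline.isCompact_preimage hK.isCompact)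
    ⟨0, preimage_interior_subset_interior_preimage hline.continuous
      (by simpa using hK.zero_mem_interior)⟩
    (hK.encard_frontier_preimage_smul_le_two hx)
  have hstar := hconv.starConvex (x := 0) (by simpa using hK.zero_mem)
  simpa using starConvex_zero_iff.1 hstar (x := 1) (by simpa using hxK) hs0 hs1

theorem mem_iff_gauge_le_one (hK : IsStarBody K) {x : E} : x ∈ K ↔ gauge K x ≤ 1 := by
  refine ⟨gauge_le_one_of_mem, fun hx => ?_⟩
  have hcont : Continuous fun t : ℝ => t • x := by fun_prop
  have hlim : Tendsto (fun t : ℝ => t • x) (𝓝[<] 1) (𝓝 x) :=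
    (hcont.tendsto' 1 x (one_smul ℝ x)).mono_left nhdsWithin_le_nhds
  refine hK.isCompact.isClosed.mem_of_tendsto hlim ?_
  filter_upwards [Ioo_mem_nhdsLT one_pos] with t ht
  by_contra htx
  have h1 := one_le_gauge_of_notMem hK.starConvex (hK.absorbent _) htx
  rw [gauge_smul_of_nonneg ht.1.le, smul_eq_mul] at h1
  nlinarith [ht.1, ht.2]

theorem gauge_pos (hK : IsStarBody K) {x : E} (hx : x ≠ 0) : 0 < gauge K x :=
  (_root_.gauge_pos hK.absorbent hK.isVonNBounded).2 hx

theorem exists_div_gauge_mem_Icc (hK : IsStarBody K) (hball : K ⊆ Metric.ball 0 1) :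
    ∃ R ∈ Ioo (0 : ℝ) 1, ∀ x, ‖x‖ / gauge K x ∈ Icc 0 R := by
  obtain ⟨y, hy, hmax⟩ := hK.isCompact.exists_isMaxOn ⟨0, hK.zero_mem⟩ continuous_norm.continuousOn
  obtain ⟨R, hyR, hR1⟩ := exists_between (mem_ball_zero_iff.1 (hball hy))
  have hR0 : 0 < R := (norm_nonneg y).trans_lt hyR
  refine ⟨R, ⟨hR0, hR1⟩, fun x => ⟨div_nonneg (norm_nonneg x) (gauge_nonneg x), ?_⟩⟩
  have hgauge := le_gauge_of_subset_closedBall (x := x) hK.absorbent hR0.le fun z hz =>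
    mem_closedBall_zero_iff.2 ((hmax hz).trans hyR.le)
  exact div_le_of_le_mul₀ (gauge_nonneg x) hR0.le ((div_le_iff₀' hR0).1 hgauge)

end IsStarBody

end StarBody

section ComplexCoordinates

variable {n : ℕ}

theorem cCoord_ext {x y : RSpace n} (h : ∀ k, cCoord x k = cCoord y k) : x = y := by
  ext ⟨k, i⟩
  fin_cases i
  exacts [congrArg Complex.re (h k), congrArg Complex.im (h k)]

theorem cCoord_add (x y : RSpace n) (k : Fin n) :
    cCoord (x + y) k = cCoord x k + cCoord y k := by
  apply Complex.ext <;> simp [cCoord]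

theorem cCoord_real_smul (c : ℝ) (x : RSpace n) (k : Fin n) :
    cCoord (c • x) k = c * cCoord x k := by
  apply Complex.ext <;> simp [cCoord]

theorem inner_eq_re_sum_cCoord (x y : RSpace n) :
    inner ℝ x y = (∑ k, cCoord x k * (starRingEnd ℂ) (cCoord y k)).re := by
  rw [PiLp.inner_apply, Fintype.sum_prod_type, Complex.re_sum]
  refine Finset.sum_congr rfl fun k _ => ?_
  simp only [cCoord, Fin.sum_univ_two, RCLike.inner_apply, conj_trivial, Complex.mul_re,
    Complex.conj_re, Complex.conj_im]
  ring

theorem norm_sq_eq_sum_norm_sq_cCoord (x : RSpace n) : ‖x‖ ^ 2 = ∑ k, ‖cCoord x k‖ ^ 2 := by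
  simp only [← real_inner_self_eq_norm_sq x, inner_eq_re_sum_cCoord, Complex.mul_conj,
    Complex.re_sum, Complex.ofReal_re, Complex.normSq_eq_norm_sq]

/-- The complex structure `ℝ^{2n} = ℂ^n` given by the coordinates `cCoord`. -/
instance : SMul ℂ (RSpace n) where
  smul z x := WithLp.toLp 2 fun p =>
    if p.2 = 0 then (z * cCoord x p.1).re else (z * cCoord x p.1).im

theorem cCoord_smul (z : ℂ) (x : RSpace n) (k : Fin n) : cCoord (z • x) k = z * cCoord x k :=
  Complex.ext rfl rfl

instance : Module ℂ (RSpace n) where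
  one_smul x := cCoord_ext fun k => by simp [cCoord_smul]
  mul_smul z w x := cCoord_ext fun k => by simp [cCoord_smul, mul_assoc]
  smul_zero z := cCoord_ext fun k => by
    have h : cCoord (0 : RSpace n) k = 0 := rfl
    rw [cCoord_smul, h, mul_zero]
  smul_add z x y := cCoord_ext fun k => by simp [cCoord_smul, cCoord_add, mul_add]
  add_smul z w x := cCoord_ext fun k => by simp [cCoord_smul, cCoord_add, add_mul]
  zero_smul x := cCoord_ext fun k => by
    rw [cCoord_smul, zero_mul]; rfl

instance : NormedSpace ℂ (RSpace n) where
  norm_smul_le z x := by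
    refine (pow_le_pow_iff_left₀ (norm_nonneg _) (by positivity) two_ne_zero).1 (le_of_eq ?_)
    simp only [mul_pow, norm_sq_eq_sum_norm_sq_cCoord, cCoord_smul, norm_mul, Finset.mul_sum]

instance : IsScalarTower ℝ ℂ (RSpace n) where
  smul_assoc r z x := cCoord_ext fun k => by
    simp only [cCoord_smul, cCoord_real_smul, Complex.real_smul, mul_assoc]

theorem rotate_eq_exp_smul (θ : ℝ) (x : RSpace n) :
    rotate θ x = Complex.exp (θ * Complex.I) • x := by
  refine cCoord_ext fun k => ?_
  rw [cCoord_smul]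
  apply Complex.ext
  · simp [cCoord, rotate, Complex.exp_ofReal_mul_I_re, Complex.exp_ofReal_mul_I_im]
  · simp [cCoord, rotate, Complex.exp_ofReal_mul_I_re, Complex.exp_ofReal_mul_I_im, add_comm]

theorem complexHyperplane_eq_complexOrthogonal (x : RSpace n) :
    complexHyperplane x = complexOrthogonal x := by
  ext y
  set c := ∑ k, cCoord y k * (starRingEnd ℂ) (cCoord x k) with hc
  have hinner : ∀ z : ℂ, inner ℝ (z • x) y = ((starRingEnd ℂ) z * c).re := fun z => by
    rw [real_inner_comm, inner_eq_re_sum_cCoord, hc, Finset.mul_sum]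
    simp only [cCoord_smul, map_mul, mul_left_comm]
  rw [mem_complexOrthogonal]
  simp only [hinner]
  refine ⟨fun h z => by rw [show c = 0 from h, mul_zero, Complex.zero_re], fun h => ?_⟩
  have hcc := h c
  rw [mul_comm, Complex.mul_conj, Complex.ofReal_re] at hcc
  exact Complex.normSq_eq_zero.1 hcc

theorem finrank_rSpace (n : ℕ) : Module.finrank ℝ (RSpace n) = 2 * n := by
  rw [finrank_euclideanSpace, Fintype.card_prod, Fintype.card_fin, Fintype.card_fin, mul_comm]

theorem IsRotationInvariant.gauge_smul {K : Set (RSpace n)} (hrot : IsRotationInvariant K)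
    (z : ℂ) (x : RSpace n) : gauge K (z • x) = ‖z‖ * gauge K x := by
  have hpi := Real.pi_pos
  obtain ⟨θ, hθ, hexp⟩ : ∃ θ ∈ Icc (0 : ℝ) (2 * Real.pi),
      Complex.exp (θ * Complex.I) = Complex.exp (z.arg * Complex.I) := by
    rcases le_or_gt 0 z.arg with h | h
    · exact ⟨z.arg, ⟨h, by linarith [Complex.arg_le_pi z]⟩, rfl⟩
    · refine ⟨z.arg + 2 * Real.pi, ⟨by linarith [Complex.neg_pi_lt_arg z], by linarith⟩, ?_⟩
      push_cast
      rw [add_mul, Complex.exp_add, Complex.exp_two_pi_mul_I, mul_one]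
  have hz : z • x = ‖z‖ • rotate θ x := by
    rw [rotate_eq_exp_smul, hexp, ← smul_assoc, Complex.real_smul, Complex.norm_mul_exp_arg_mul_I]
  rw [hz, gauge_smul_of_nonneg (norm_nonneg z), ← hrot θ hθ, smul_eq_mul]

end ComplexCoordinates

section HyperbolicVolume

/-- The hyperbolic volume density on `K` in the ball model, without the factor `8 ^ (n - 1)`. -/
def hypDensity {E : Type*} [Norm E] (n : ℕ) (K : Set E) : E → ENNReal :=
  K.indicator fun x => ENNReal.ofReal ((1 - ‖x‖ ^ 2) ^ n)⁻¹

theorem measurable_hypDensity {E : Type*} [NormedAddCommGroup E] [MeasurableSpace E]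
    [OpensMeasurableSpace E] (n : ℕ) {K : Set E} (hK : MeasurableSet K) :
    Measurable (hypDensity n K) :=
  Measurable.indicator (by fun_prop) hK

theorem hypMeasure_apply (m : ℕ) {V : Type*} [NormedAddCommGroup V] [InnerProductSpace ℝ V]
    [FiniteDimensional ℝ V] [MeasurableSpace V] [BorelSpace V] {A : Set V}
    (hA : MeasurableSet A) (hball : A ⊆ Metric.ball 0 1) :
    hypMeasure m V A = ENNReal.ofReal (8 ^ m) * ∫⁻ x, hypDensity (m + 1) A x := by
  simp only [hypMeasure, hypDensity]
  rw [withDensity_apply _ hA, Measure.restrict_restrict hA, inter_eq_left.2 hball,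
    lintegral_indicator hA, ← lintegral_const_mul' _ _ ENNReal.ofReal_ne_top]
  simp only [div_eq_mul_inv, ENNReal.ofReal_mul (by positivity : (0 : ℝ) ≤ 8 ^ m)]

end HyperbolicVolume

section SectionKernel

theorem mul_lintegral_Ioi_indicator_comp_smul {E : Type*} [NormedAddCommGroup E] [NormedSpace ℝ E]
    {K : Set E} (hK : IsStarBody K) (k : ℕ) (w : ℝ → ENNReal) {x : E} (hx : x ≠ 0) :
    ENNReal.ofReal (‖x‖ ^ (k + 1)) * ∫⁻ s in Ioi (0 : ℝ),
        ENNReal.ofReal (s ^ k) * K.indicator (fun y => w ‖y‖) (s • x) =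
      ∫⁻ r in Ioc 0 (‖x‖ / gauge K x), ENNReal.ofReal (r ^ k) * w r := by
  have hxn : 0 < ‖x‖ := norm_pos_iff.2 hx
  have hgx := hK.gauge_pos hx
  rw [← lintegral_indicator measurableSet_Ioc, ← lintegral_indicator measurableSet_Ioi,
    lintegral_eq_mul_lintegral_comp_smul hxn (Set.indicator (Ioc _ _) _), Module.finrank_self,
    pow_one, pow_succ', ENNReal.ofReal_mul hxn.le, mul_assoc,
    ← lintegral_const_mul' _ _ ENNReal.ofReal_ne_top]
  congr 1
  refine lintegral_congr fun s => ?_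
  rw [smul_eq_mul]
  by_cases hs : s ∈ Ioi (0 : ℝ)
  · have hs0 : 0 < s := hs
    have hnorm : ‖s • x‖ = ‖x‖ * s := by rw [norm_smul, Real.norm_of_nonneg hs0.le, mul_comm]
    have hmem : ‖x‖ * s ∈ Ioc 0 (‖x‖ / gauge K x) ↔ s • x ∈ K := by
      rw [hK.mem_iff_gauge_le_one, gauge_smul_of_nonneg hs0.le, smul_eq_mul, ← le_div_iff₀ hgx,
        ← mul_le_mul_iff_right₀ hxn, mul_one_div]
      exact and_iff_right (by positivity)
    simp only [indicator_of_mem hs]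
    by_cases hsK : s • x ∈ K
    · rw [indicator_of_mem (hmem.2 hsK), indicator_of_mem hsK, hnorm, ← mul_assoc,
        ← ENNReal.ofReal_mul (by positivity), mul_pow]
    · rw [indicator_of_notMem (mt hmem.1 hsK), indicator_of_notMem hsK, mul_zero, mul_zero]
  · rw [indicator_of_notMem hs, mul_zero, indicator_of_notMem fun h =>
      hs (pos_of_mul_pos_right h.1 hxn.le)]

theorem continuousOn_pow_div_one_sub_sq_pow (k n : ℕ) {R : ℝ} (hR : R < 1) :
    ContinuousOn (fun r : ℝ => r ^ k / (1 - r ^ 2) ^ n) (Icc 0 R) := by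
  refine ContinuousOn.div (by fun_prop) (by fun_prop) fun r hr => pow_ne_zero _ ?_
  nlinarith [hr.1, hr.2]

theorem one_sub_sq_pow_nonneg (n : ℕ) {r : ℝ} (h0 : 0 ≤ r) (h1 : r ≤ 1) :
    0 ≤ (1 - r ^ 2) ^ n :=
  pow_nonneg (sub_nonneg.2 (pow_le_one₀ h0 h1)) n

variable {n : ℕ} {K : Set (RSpace n)}

theorem sectionKernel_eq (hn : 2 ≤ n) (x : RSpace n) :
    sectionKernel K x = (‖x‖ ^ (2 * n - 2))⁻¹ *
      ∫ r in (0 : ℝ)..(‖x‖ / gauge K x), r ^ (2 * n - 3) / (1 - r ^ 2) ^ n := by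
  have hexp : -2 * (n : ℤ) + 2 = -((2 * n - 2 : ℕ) : ℤ) := by omega
  rw [sectionKernel, hexp, zpow_neg, zpow_natCast]

theorem isNegHomogeneous_sectionKernel (hn : 2 ≤ n) (hrot : IsRotationInvariant K) :
    IsNegHomogeneous ℂ (2 * n - 2) (sectionKernel K) := fun c hc x => by
  rw [sectionKernel_eq hn, sectionKernel_eq hn, hrot.gauge_smul, norm_smul,
    mul_div_mul_left _ _ (norm_ne_zero_iff.2 hc), mul_pow, mul_inv, mul_assoc, smul_eq_mul]

theorem continuousOn_sectionKernel (hn : 2 ≤ n) (hK : IsStarBody K) (hball : K ⊆ Metric.ball 0 1)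
    (hcont : Continuous (gauge K)) : ContinuousOn (sectionKernel K) {0}ᶜ := by
  obtain ⟨R, ⟨hR0, hR1⟩, hR⟩ := hK.exists_div_gauge_mem_Icc hball
  have hprimitive : ContinuousOn
      (fun ρ => ∫ r in (0 : ℝ)..ρ, r ^ (2 * n - 3) / (1 - r ^ 2) ^ n) (Icc 0 R) := by
    rw [← uIcc_of_le hR0.le]
    refine intervalIntegral.continuousOn_primitive_interval ?_
    rw [uIcc_of_le hR0.le]
    exact (continuousOn_pow_div_one_sub_sq_pow _ n hR1).integrableOn_Icc
  have hradius : ContinuousOn (fun x => ‖x‖ / gauge K x) {0}ᶜ :=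
    continuous_norm.continuousOn.div hcont.continuousOn fun x hx => (hK.gauge_pos hx).ne'
  have hpow : ContinuousOn (fun x : RSpace n => (‖x‖ ^ (2 * n - 2))⁻¹) {0}ᶜ :=
    ContinuousOn.inv₀ (by fun_prop) fun x hx => pow_ne_zero _ (norm_ne_zero_iff.2 hx)
  exact (hpow.mul (hprimitive.comp hradius fun x _ => hR x)).congr fun x _ => sectionKernel_eq hn x

theorem sectionKernel_nonneg (hn : 2 ≤ n) (hK : IsStarBody K) (hball : K ⊆ Metric.ball 0 1)
    (x : RSpace n) : 0 ≤ sectionKernel K x := by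
  obtain ⟨R, ⟨-, hR1⟩, hR⟩ := hK.exists_div_gauge_mem_Icc hball
  rw [sectionKernel_eq hn]
  refine mul_nonneg (by positivity) (intervalIntegral.integral_nonneg (hR x).1 fun r hr => ?_)
  exact div_nonneg (pow_nonneg hr.1 _)
    (one_sub_sq_pow_nonneg n hr.1 ((hr.2.trans (hR x).2).trans hR1.le))

theorem radialCutoff_sectionKernel_nonneg (hn : 2 ≤ n) (hK : IsStarBody K)
    (hball : K ⊆ Metric.ball 0 1) (x : RSpace n) : 0 ≤ radialCutoff (sectionKernel K) x :=
  smul_nonneg (radialBump_nonneg _) (sectionKernel_nonneg hn hK hball x)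

theorem ofReal_sectionKernel (hn : 2 ≤ n) (hK : IsStarBody K) (hball : K ⊆ Metric.ball 0 1)
    {x : RSpace n} (hx : x ≠ 0) :
    ENNReal.ofReal (sectionKernel K x) =
      ∫⁻ s in Ioi (0 : ℝ), ENNReal.ofReal (s ^ (2 * n - 3)) * hypDensity n K (s • x) := by
  obtain ⟨R, ⟨-, hR1⟩, hR⟩ := hK.exists_div_gauge_mem_Icc hball
  have hxn : 0 < ‖x‖ ^ (2 * n - 2) := by positivity
  have hdeg : 2 * n - 2 = 2 * n - 3 + 1 := by omega
  have hradius : ‖x‖ / gauge K x < 1 := (hR x).2.trans_lt hR1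
  have hprofile : ENNReal.ofReal
        (∫ r in (0 : ℝ)..(‖x‖ / gauge K x), r ^ (2 * n - 3) / (1 - r ^ 2) ^ n) =
      ∫⁻ r in Ioc 0 (‖x‖ / gauge K x),
        ENNReal.ofReal (r ^ (2 * n - 3)) * ENNReal.ofReal ((1 - r ^ 2) ^ n)⁻¹ := by
    rw [intervalIntegral.integral_of_le (hR x).1, ofReal_integral_eq_lintegral_ofReal
      ((continuousOn_pow_div_one_sub_sq_pow _ n hradius).integrableOn_Icc.mono_set
        Ioc_subset_Icc_self)]
    · refine setLIntegral_congr_fun measurableSet_Ioc fun r hr => ?_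
      rw [div_eq_mul_inv, ENNReal.ofReal_mul (pow_nonneg hr.1.le _)]
    · filter_upwards [ae_restrict_mem measurableSet_Ioc] with r hr
      exact div_nonneg (pow_nonneg hr.1.le _)
        (one_sub_sq_pow_nonneg n hr.1.le (hr.2.trans hradius.le))
  refine (ENNReal.mul_right_inj (ENNReal.ofReal_pos.2 hxn).ne' ENNReal.ofReal_ne_top).1 ?_
  rw [← ENNReal.ofReal_mul hxn.le, sectionKernel_eq hn, mul_inv_cancel_left₀ hxn.ne', hprofile,
    hdeg]
  exact (mul_lintegral_Ioi_indicator_comp_smul hK _ _ hx).symm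

theorem hypSectionVolume_eq_hypMeasure (K : Set (RSpace n)) (ξ : RSpace n) :
    hypSectionVolume K ξ = hypMeasure (n - 1) (complexOrthogonal ξ) (Subtype.val ⁻¹' K) := by
  have h : ∀ S, complexHyperplane ξ = S →
      hypSectionVolume K ξ = hypMeasure (n - 1) S (Subtype.val ⁻¹' K) := by
    rintro _ rfl
    rfl
  exact h _ (complexHyperplane_eq_complexOrthogonal ξ)

theorem hypSectionVolume_eq (hn : 2 ≤ n) (hK : IsStarBody K) (hball : K ⊆ Metric.ball 0 1)
    (hcont : Continuous (gauge K)) {ξ : RSpace n} (hξ : ξ ≠ 0) :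
    hypSectionVolume K ξ =
      ENNReal.ofReal (8 ^ (n - 1) * hyperplaneIntegral (radialCutoff (sectionKernel K)) ξ) := by
  have hdim : Module.finrank ℝ (complexOrthogonal ξ) = 2 * n - 2 := by
    rw [finrank_complexOrthogonal hξ, finrank_rSpace]
  have : Nontrivial (complexOrthogonal ξ) :=
    Module.nontrivial_of_finrank_pos (R := ℝ) (by omega)
  have hKmeas := hK.isCompact.isClosed.measurableSet
  have hcut := integrable_comp_complexOrthogonal
    (continuous_radialCutoff (continuousOn_sectionKernel hn hK hball hcont))
    (hasCompactSupport_radialCutoff _) ξ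
  rw [hypSectionVolume_eq_hypMeasure, hypMeasure_apply _
    (hKmeas.preimage measurable_subtype_coe) fun x hx => by simpa using hball hx,
    ENNReal.ofReal_mul (by positivity), hyperplaneIntegral,
    ofReal_integral_eq_lintegral_ofReal hcut (Eventually.of_forall fun y =>
      radialCutoff_sectionKernel_nonneg hn hK hball y),
    lintegral_eq_lintegral_radialBump_mul
      (measurable_hypDensity _ (hKmeas.preimage measurable_subtype_coe))]
  congr 1
  refine lintegral_congr_ae ?_
  filter_upwards [Measure.ae_ne volume (0 : complexOrthogonal ξ)] with y hy
  rw [radialCutoff, smul_eq_mul, ENNReal.ofReal_mul (radialBump_nonneg _),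
    ofReal_sectionKernel hn hK hball (by simpa using hy), hdim, Nat.sub_add_cancel (by omega)]
  rfl

end SectionKernel

end

end ComplexHyperbolic

open ComplexHyperbolic in
theorem lemma5 (n : ℕ) (hn : 2 ≤ n) (K : Set (RSpace n))
    (hK : IsStarBody K) (hcont : Continuous (gauge K)) (hrot : IsRotationInvariant K)
    (hball : K ⊆ Metric.ball 0 1) :
    ∃ T : TemperedDistribution (RSpace n) ℂ, IsGivenBy T (sectionKernel K) ∧
      ∃ g : RSpace n → ℝ, ContinuousOn g {0}ᶜ ∧ IsGivenBy (distFourier T) g ∧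
        ∀ ξ : RSpace n, ‖ξ‖ = 1 →
          hypSectionVolume K ξ ≠ ⊤ ∧
          (hypSectionVolume K ξ).toReal = 8 ^ (n - 1) / (2 * Real.pi) * g ξ := by
  have hdim : 2 < Module.finrank ℝ (RSpace n) := by rw [finrank_rSpace]; omega
  have hkernel := continuousOn_sectionKernel hn hK hball hcont
  have hhom : IsNegHomogeneous ℂ (Module.finrank ℝ (RSpace n) - 2) (sectionKernel K) := by
    rw [finrank_rSpace]; exact isNegHomogeneous_sectionKernel hn hrot
  obtain ⟨T, hT⟩ := exists_isGivenBy_of_isNegHomogeneous hdim hhom hkernel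
  refine ⟨T, hT, fourierDensity (sectionKernel K), continuousOn_fourierDensity hkernel,
    isGivenBy_distFourier hdim hhom hkernel hT, fun ξ hξ => ?_⟩
  have hξ0 : ξ ≠ 0 := norm_ne_zero_iff.1 (hξ ▸ one_ne_zero)
  have hnonneg : 0 ≤ hyperplaneIntegral (radialCutoff (sectionKernel K)) ξ :=
    MeasureTheory.integral_nonneg fun y => radialCutoff_sectionKernel_nonneg hn hK hball y
  rw [hypSectionVolume_eq hn hK hball hcont hξ0]
  refine ⟨ENNReal.ofReal_ne_top, ?_⟩
  rw [ENNReal.toReal_ofReal (by positivity), fourierDensity, hξ]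
  field_simp
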